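/- **Theorem (weak rigidity for active scalars with odd multipliers).** Let $n\ge 0$, let $\mathbb T^n=(\mathbb R/\mathbb Z)^n$, let $I\subseteq\mathbb R$ be an open interval (possibly unbounded), and let $m=(m^1,\dots,m^n):\mathbb R^n\to\mathbb C^n$ be smooth on $\mathbb R^n\setminus\{0\}$ and satisfy * $m(r\xi)=m(\xi)$ for all $r>0$ and $\xi\neq 0$ (homogeneity of degree $0$); * $m^l(-\xi)=\overline{m^l(\xi)}$ for all $\xi$ and all $l$; * $\xi\cdot m(\xi)=0$ for all $\xi\ne 0$; * $m(-\xi)=-m(\xi)$ for all $\xi\neq 0$ ($m$ is odd). For real-valued $\theta\in L^2(\mathbb T^n)$, let $T^l[\theta]\in L^2(\mathbb T^n)$ be the function with Fourier coefficients $\widehat{T^l[\theta]}(k)=m^l(k)\,\hat\theta(k)$, $k\in\mathbb Z^n$. Consider on $I\times\mathbb T^n$ the active scalar equation with divergence free drift velocity $$\partial_t\theta+\partial_l(\theta u^l)=0,\qquad u^l=T^l[\theta],\qquad \partial_l u^l=0 \tag{1}$$ (repeated indices are summed). For $p\in(2,\infty]$, a real-valued $\theta\in L^p(I;L^2(\mathbb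 T^n))$ is called a *weak solution* of (1) if, with $u^l(t)=T^l[\theta(t)]$ for almost every $t\in I$, one has $$\int_I\int_{\mathbb T^n}\big(\theta\,\partial_t\varphi+\theta\,u^l\,\partial_l\varphi\big)\,dx\,dt=0\quad\text{and}\quad \int_I\int_{\mathbb T^n}u^l\,\partial_l\varphi\,dx\,dt=0$$ for every $\varphi\in C_c^\infty(I\times\mathbb T^n)$. Let $p\in(2,\infty]$, let $(\theta_k)_{k\in\mathbb N}$ be a sequence of weak solutions of (1) in $L^p(I;L^2(\mathbb T^n))$, and suppose that $\theta_k$ converges to $f\in L^p(I;L^2(\mathbb T^n))$ weakly in $L^p(I;L^2(\mathbb T^n))$ (weakly-$*$ if $p=\infty$), that is, for $\frac1p+\frac1q=1$, $$\int_I\langle\theta_k(t),g(t)\rangle_{L^2(\mathbb T^n)}\,dt\;\longrightarrow\;\int_I\langle f(t),g(t)\rangle_{L^2(\mathbb T^n)}\,dt\qquad\text{for every } g\in L^q(I;L^2(\mathbb T^n)).$$ Then $f$ is a weak solution of (1). -/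

import Mathlib

open MeasureTheory Filter Topology
open scoped ENNReal ContDiff

noncomputable section

namespace ActiveScalar

/-- The torus `𝕋ⁿ = (ℝ/ℤ)ⁿ`; its characters are `x ↦ exp (2πi k·x)`, `k ∈ ℤⁿ`. -/
abbrev Torus (n : ℕ) : Type := UnitAddTorus (Fin n)

/-- The normalized Lebesgue (Haar) measure `dx` on the torus, of total mass `1`.  It is the measure
with respect to which Mathlib's multivariate Fourier coefficients are defined. -/
abbrev torusMeasure (n : ℕ) : Measure (Torus n) :=
  Measure.pi (fun _ : Fin n => (AddCircle.haarAddCircle : Measure UnitAddCircle))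

/-- The real Hilbert space `L²(𝕋ⁿ)`. -/
abbrev L2Torus (n : ℕ) : Type := Lp ℝ 2 (torusMeasure n)

/-- The Bochner space `Lᵖ(I; L²(𝕋ⁿ))`. -/
abbrev LpL2 (n : ℕ) (I : Set ℝ) (p : ℝ≥0∞) : Type :=
  Lp (L2Torus n) p ((volume : Measure ℝ).restrict I)

/-- The standing assumptions on the (vector valued) symbol `m = (m¹, …, mⁿ)` of
`T = (T¹, …, Tⁿ)`: smooth away from the origin, homogeneous of degree `0`, such that `T` maps
real-valued functions to real-valued ones, and such that the drift velocity is divergence free.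
The value at the single frequency `ξ = 0` is only constrained by the reality condition. -/
structure IsSymbol {n : ℕ} (m : (Fin n → ℝ) → Fin n → ℂ) : Prop where
  smooth : ContDiffOn ℝ ∞ m {0}ᶜ
  homogeneous : ∀ (r : ℝ) (ξ : Fin n → ℝ), 0 < r → ξ ≠ 0 → m (r • ξ) = m ξ
  reality : ∀ (ξ : Fin n → ℝ) (l : Fin n), m (-ξ) l = (starRingEnd ℂ) (m ξ l)
  perp : ∀ ξ : Fin n → ℝ, ξ ≠ 0 → ∑ l, (ξ l : ℂ) * m ξ l = 0

/-- Fourier coefficient at `k ∈ ℤⁿ` of a real-valued `L²` function on the torus. -/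
def fourierCoeff {n : ℕ} (v : L2Torus n) (k : Fin n → ℤ) : ℂ :=
  UnitAddTorus.mFourierCoeff (fun x : Torus n => ((v x : ℝ) : ℂ)) k

/-- `u = (u¹, …, uⁿ)` is the drift velocity `T[θ]` for `θ ∈ L²(𝕋ⁿ)`: on the Fourier side,
`ûˡ(k) = mˡ(k) θ̂(k)` for every `k ∈ ℤⁿ`.  (The frequency of the `k`-th character is `2πk`, and
`m (2πk) = m k` for `k ≠ 0` by homogeneity.) -/
def IsDrift {n : ℕ} (m : (Fin n → ℝ) → Fin n → ℂ) (θ : L2Torus n) (u : Fin n → L2Torus n) :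
    Prop :=
  ∀ (l : Fin n) (k : Fin n → ℤ),
    fourierCoeff (u l) k = m (fun i => (k i : ℝ)) l * fourierCoeff θ k

/-- Real-valued test functions `φ ∈ C_c^∞(I × 𝕋ⁿ)`: the periodic lift of `φ` to `ℝ × ℝⁿ` is
smooth, and `φ` vanishes for times outside a compact subset of `I`. -/
structure IsTestFunction {n : ℕ} (I : Set ℝ) (φ : ℝ → Torus n → ℝ) : Prop where
  smooth : ContDiff ℝ ∞
    (fun z : ℝ × (Fin n → ℝ) => φ z.1 (fun i => ((z.2 i : ℝ) : UnitAddCircle)))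
  compactSupport : ∃ K : Set ℝ, IsCompact K ∧ K ⊆ I ∧ ∀ t, t ∉ K → ∀ x, φ t x = 0

/-- The time derivative `∂ₜφ`. -/
def dt {n : ℕ} (φ : ℝ → Torus n → ℝ) (t : ℝ) (x : Torus n) : ℝ :=
  deriv (fun s : ℝ => φ s x) t

/-- The space derivative `∂ₗφ`, in the direction of the `l`-th coordinate of the torus. -/
def dx {n : ℕ} (l : Fin n) (φ : ℝ → Torus n → ℝ) (t : ℝ) (x : Torus n) : ℝ :=
  deriv (fun s : ℝ => φ t (x + Pi.single l (s : UnitAddCircle))) 0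

/-- `θ ∈ Lᵖ(I; L²(𝕋ⁿ))` is a weak solution on `I × 𝕋ⁿ` of the active scalar equation
`∂ₜθ + ∂ₗ(θ uˡ) = 0`, `uˡ = Tˡ[θ]`, `∂ₗuˡ = 0`, the two differential equations being understood in
the sense of distributions. -/
def IsWeakSolution {n : ℕ} {I : Set ℝ} {p : ℝ≥0∞} (m : (Fin n → ℝ) → Fin n → ℂ)
    (θ : LpL2 n I p) : Prop :=
  ∃ u : Fin n → LpL2 n I p,
    (∀ᵐ t ∂((volume : Measure ℝ).restrict I), IsDrift m (θ t) (fun l => u l t)) ∧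
    (∀ φ : ℝ → Torus n → ℝ, IsTestFunction I φ →
      ∫ t in I, ∫ x, ∑ l, (u l t) x * dx l φ t x ∂(torusMeasure n) = 0) ∧
    (∀ φ : ℝ → Torus n → ℝ, IsTestFunction I φ →
      ∫ t in I, ∫ x,
        ((θ t) x * dt φ t x + ∑ l, (θ t) x * (u l t) x * dx l φ t x) ∂(torusMeasure n) = 0)

/-- Weak convergence `θₖ ⇀ f` in `Lᵖ(I; L²(𝕋ⁿ))`: convergence of `∫_I ⟨θₖ(t), g(t)⟩ dt` for
every `g ∈ L^q(I; L²(𝕋ⁿ))`, where `1/p + 1/q = 1`.  For `p = ∞` this is weak-* convergence,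
which is implied by weak convergence. -/
def WeaklyTendsto {n : ℕ} {I : Set ℝ} {p : ℝ≥0∞} (θ : ℕ → LpL2 n I p) (f : LpL2 n I p) : Prop :=
  ∀ q : ℝ≥0∞, p.HolderConjugate q → ∀ g : LpL2 n I q,
    Tendsto (fun k => ∫ t in I, inner ℝ (θ k t) (g t)) atTop
      (𝓝 (∫ t in I, inner ℝ (f t) (g t)))

end ActiveScalar

end

/-!
# Weak limits of solutions of active scalar equations with odd multipliers

The only nonlinear term of the weak formulation is `∫_I ∑ₗ ∫ θ Tˡ[θ] ∂ₗφ dx dt`; two effects make it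
converge along a weakly convergent sequence of solutions.

*Cancellation in space.*  For a character `ψ = e_h` of the torus, Parseval's identity and the
symmetrization `k ↦ h - k` give
`∫ e_h θ Tˡ[θ] dx = ½ ∑ₖ (mˡ(k - h) + mˡ(-k)) conj θ̂(k) θ̂(k - h)` (`hasSum_quadForm_mFourier`).
Since `m` is odd, homogeneous of degree `0` and uniformly continuous on the unit sphere, the factor
`mˡ(k - h) + mˡ(-k) = mˡ(k - h) - mˡ(k)` tends to `0` as `k → ∞`
(`tendsto_latticeSymbol_add`); at `k = 0` this identity may fail, as oddness says nothing about
`m(0)`, but finitely many terms do no harm.  Hence, up to `ε ‖θ‖²`, the form depends on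
finitely many Fourier coefficients.  Trigonometric polynomials being dense in `C(𝕋ⁿ)`, the same
holds for every continuous weight `ψ`, uniformly over compact sets of weights
(`isFinitelyControlled_of_isCompact`); neither a rate of decay nor the gradient structure of `∂ₗφ`
is needed.

*Compactness in time.*  By the Banach–Steinhaus theorem the weakly convergent sequence is bounded
as a set of functionals on `L^q`; testing with `1_E θ` and using `q < 2` yields
`∫_E ‖θ‖² ≤ C |E|^α` with `α > 0` (`WeaklyTendsto.exists_setIntegral_le`).  This is where `p > 2`
enters.  The equation bounds the time derivative of `∫ θ(t) w dx`, for smooth `w`, by a multiple of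
`‖θ(t)‖²`, so that these moments are equi-Hölder in a weak sense
(`IsWeakSolution.hasWeakHolderBound`).  Comparison with mollifications in time turns their weak
convergence into bounded convergence almost everywhere (`ae_tendsto_of_hasWeakHolderBound`).  In
particular, products of Fourier coefficients converge in `L¹` on compact time intervals
(`tendsto_setIntegral_pairDiff`), which with the first effect gives
`tendsto_integral_realQuadForm`.

The linear terms converge by weak convergence, the divergence constraint after moving `Tˡ` onto the
test function by taking its adjoint.
-/

noncomputable section

namespace ActiveScalar

open scoped ComplexConjugate InnerProductSpace

/-! ### `L²` of the torus: Fourier coefficients, multipliers, multiplication operators -/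

section

variable {n : ℕ}

/-- The complex Hilbert space `L²(𝕋ⁿ; ℂ)`. -/
abbrev L2TorusC (n : ℕ) : Type := Lp ℂ 2 (torusMeasure n)

/-- The Fourier basis of `L²(𝕋ⁿ; ℂ)`, with respect to `torusMeasure`. -/
def torusBasis (n : ℕ) : HilbertBasis (Fin n → ℤ) ℂ (L2TorusC n) := UnitAddTorus.mFourierBasis

/-- The embedding of real-valued into complex-valued functions. -/
def ofRealL (n : ℕ) : L2Torus n →L[ℝ] L2TorusC n :=
  Complex.ofRealCLM.compLpL 2 (torusMeasure n)

/-- The real part of a complex-valued function. -/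
def reL (n : ℕ) : L2TorusC n →L[ℝ] L2Torus n :=
  Complex.reCLM.compLpL 2 (torusMeasure n)

lemma coeFn_ofRealL (v : L2Torus n) :
    (ofRealL n v : Torus n → ℂ) =ᵐ[torusMeasure n] fun x => ((v x : ℝ) : ℂ) :=
  Complex.ofRealCLM.coeFn_compLpL v

lemma coeFn_reL (v : L2TorusC n) :
    (reL n v : Torus n → ℝ) =ᵐ[torusMeasure n] fun x => (v x).re :=
  Complex.reCLM.coeFn_compLpL v

lemma repr_torusBasis (v : L2TorusC n) (k : Fin n → ℤ) :
    (torusBasis n).repr v k = ∫ x, UnitAddTorus.mFourier (-k) x * v x ∂torusMeasure n :=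
  UnitAddTorus.mFourierBasis_repr v k

lemma fourierCoeff_eq_integral (v : L2Torus n) (k : Fin n → ℤ) :
    fourierCoeff v k = ∫ x, UnitAddTorus.mFourier (-k) x * (v x : ℂ) ∂torusMeasure n := rfl

lemma fourierCoeff_eq_repr (v : L2Torus n) (k : Fin n → ℤ) :
    fourierCoeff v k = (torusBasis n).repr (ofRealL n v) k := by
  rw [fourierCoeff_eq_integral, repr_torusBasis]
  refine integral_congr_ae ?_
  filter_upwards [coeFn_ofRealL v] with x hx
  rw [hx]

lemma norm_ofRealL (v : L2Torus n) : ‖ofRealL n v‖ = ‖v‖ := by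
  rw [Lp.norm_def, Lp.norm_def]
  refine congrArg ENNReal.toReal (eLpNorm_congr_norm_ae ?_)
  filter_upwards [coeFn_ofRealL v] with x hx
  rw [hx, Complex.norm_real]

lemma fourierCoeff_neg (v : L2Torus n) (k : Fin n → ℤ) :
    fourierCoeff v (-k) = conj (fourierCoeff v k) := by
  rw [fourierCoeff_eq_integral, fourierCoeff_eq_integral, ← integral_conj]
  refine integral_congr_ae (Eventually.of_forall fun x => ?_)
  simp [UnitAddTorus.mFourier_neg]

lemma integrable_mFourier_mul (w : L2TorusC n) (k : Fin n → ℤ) :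
    Integrable (fun x => UnitAddTorus.mFourier k x * w x) (torusMeasure n) := by
  refine (((Lp.memLp w).integrable (by norm_num))).bdd_mul (c := 1)
    (UnitAddTorus.mFourier k).continuous.aestronglyMeasurable
    (Eventually.of_forall fun x => ?_)
  exact ((UnitAddTorus.mFourier k).norm_coe_le_norm x).trans UnitAddTorus.mFourier_norm.le

lemma fourierCoeff_reL (w : L2TorusC n) (k : Fin n → ℤ) :
    fourierCoeff (reL n w) k =
      ((torusBasis n).repr w k + conj ((torusBasis n).repr w (-k))) / 2 := by
  rw [fourierCoeff_eq_integral, repr_torusBasis, repr_torusBasis, ← integral_conj,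
    ← integral_add (integrable_mFourier_mul w _), ← integral_div]
  · refine integral_congr_ae ?_
    filter_upwards [coeFn_reL w] with x hx
    rw [hx, neg_neg, map_mul, ← UnitAddTorus.mFourier_neg, ← mul_add, Complex.add_conj]
    push_cast
    ring
  · have h := (Complex.conjCLE : ℂ →L[ℝ] ℂ).integrable_comp (integrable_mFourier_mul w (- -k))
    exact h

lemma hasSum_conj_mul_fourierCoeff (v w : L2TorusC n) :
    HasSum (fun k => conj ((torusBasis n).repr v k) * (torusBasis n).repr w k) ⟪v, w⟫_ℂ := by
  have := (torusBasis n).hasSum_inner_mul_inner v w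
  refine this.congr_fun fun k => ?_
  rw [HilbertBasis.repr_apply_apply, HilbertBasis.repr_apply_apply, inner_conj_symm]

lemma hasSum_sq_fourierCoeff (v : L2Torus n) :
    HasSum (fun k => ‖fourierCoeff v k‖ ^ 2) (‖v‖ ^ 2) := by
  have h := hasSum_conj_mul_fourierCoeff (ofRealL n v) (ofRealL n v)
  have h2 := Complex.reCLM.hasSum h
  rw [← norm_ofRealL]
  convert h2 using 1
  · ext k
    simp only [Complex.reCLM_apply, fourierCoeff_eq_repr]
    rw [Complex.conj_mul']
    norm_cast
  · rw [Complex.reCLM_apply]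
    exact (inner_self_eq_norm_sq (𝕜 := ℂ) _).symm

lemma eq_of_fourierCoeff_eq {v w : L2Torus n} (h : ∀ k, fourierCoeff v k = fourierCoeff w k) :
    v = w := by
  rw [← sub_eq_zero, ← norm_eq_zero, ← sq_eq_zero_iff]
  refine (hasSum_sq_fourierCoeff (v - w)).unique ?_
  convert hasSum_zero with k
  rw [fourierCoeff_eq_repr, map_sub, map_sub, lp.coeFn_sub, Pi.sub_apply, ← fourierCoeff_eq_repr,
    ← fourierCoeff_eq_repr, h]
  simp

/-- The Fourier coefficient as a continuous real-linear functional. -/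
def fourierCoeffL (k : Fin n → ℤ) : L2Torus n →L[ℝ] ℂ :=
  ((innerSL ℂ (torusBasis n k)).restrictScalars ℝ).comp (ofRealL n)

lemma fourierCoeffL_apply (k : Fin n → ℤ) (v : L2Torus n) :
    fourierCoeffL k v = fourierCoeff v k := by
  rw [fourierCoeff_eq_repr, HilbertBasis.repr_apply_apply]
  rfl

lemma norm_fourierCoeff_le (v : L2Torus n) (k : Fin n → ℤ) : ‖fourierCoeff v k‖ ≤ ‖v‖ := by
  rw [fourierCoeff_eq_repr, ← norm_ofRealL, HilbertBasis.repr_apply_apply]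
  refine (norm_inner_le_norm _ _).trans ?_
  rw [(torusBasis n).orthonormal.1 k, one_mul]

/-- The Fourier multiplier on `L²(𝕋ⁿ; ℂ)` with bounded symbol `a`. -/
def multiplierC (a : (Fin n → ℤ) → ℂ) {C : ℝ} (hC : 0 ≤ C) (ha : ∀ k, ‖a k‖ ≤ C) :
    L2TorusC n →L[ℂ] L2TorusC n :=
  ((torusBasis n).repr.symm.toContinuousLinearEquiv : _ →L[ℂ] _).comp
    ((lp.mapCLM 2 (fun k => a k • ContinuousLinearMap.id ℂ ℂ) hC
      (fun k => by simpa [norm_smul] using ha k)).comp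
      ((torusBasis n).repr.toContinuousLinearEquiv : _ →L[ℂ] _))

lemma repr_multiplierC (a : (Fin n → ℤ) → ℂ) {C : ℝ} (hC : 0 ≤ C) (ha : ∀ k, ‖a k‖ ≤ C)
    (v : L2TorusC n) (k : Fin n → ℤ) :
    (torusBasis n).repr (multiplierC a hC ha v) k = a k * (torusBasis n).repr v k := by
  simp [multiplierC]

/-- The Fourier multiplier with bounded symbol `a` on real-valued functions.  Taking the real part
changes nothing when `a (-k) = conj (a k)`. -/
def multiplier (a : (Fin n → ℤ) → ℂ) {C : ℝ} (hC : 0 ≤ C) (ha : ∀ k, ‖a k‖ ≤ C) :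
    L2Torus n →L[ℝ] L2Torus n :=
  (reL n).comp (((multiplierC a hC ha).restrictScalars ℝ).comp (ofRealL n))

lemma fourierCoeff_multiplier (a : (Fin n → ℤ) → ℂ) {C : ℝ} (hC : 0 ≤ C) (ha : ∀ k, ‖a k‖ ≤ C)
    (hreal : ∀ k, a (-k) = conj (a k)) (v : L2Torus n) (k : Fin n → ℤ) :
    fourierCoeff (multiplier a hC ha v) k = a k * fourierCoeff v k := by
  have : multiplier a hC ha v = reL n (multiplierC a hC ha (ofRealL n v)) := rfl
  rw [this, fourierCoeff_reL, repr_multiplierC, repr_multiplierC, ← fourierCoeff_eq_repr,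
    ← fourierCoeff_eq_repr, fourierCoeff_neg, hreal]
  simp

section Mul

variable (𝕜 : Type) [RCLike 𝕜]

/-- Multiplication of an `L²` function by a continuous function, as a bounded bilinear map. -/
def mulL (n : ℕ) : C(Torus n, 𝕜) →L[𝕜] Lp 𝕜 2 (torusMeasure n) →L[𝕜] Lp 𝕜 2 (torusMeasure n) :=
  ((ContinuousLinearMap.mul 𝕜 𝕜).holderL (torusMeasure n) ∞ 2 2).comp
    (ContinuousMap.toLp ∞ (torusMeasure n) 𝕜)

variable {𝕜}

lemma coeFn_mulL (ψ : C(Torus n, 𝕜)) (v : Lp 𝕜 2 (torusMeasure n)) :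
    (mulL 𝕜 n ψ v : Torus n → 𝕜) =ᵐ[torusMeasure n] fun x => ψ x * v x := by
  have h1 := (ContinuousLinearMap.mul 𝕜 𝕜).coeFn_holder (r := 2) (μ := torusMeasure n)
    (ContinuousMap.toLp ∞ (torusMeasure n) 𝕜 ψ) v
  have h2 := ContinuousMap.coeFn_toLp (p := ∞) (𝕜 := 𝕜) (torusMeasure n) ψ
  refine h1.trans ?_
  filter_upwards [h2] with x hx
  rw [hx]
  rfl

lemma norm_mulL_le (ψ : C(Torus n, 𝕜)) (v : Lp 𝕜 2 (torusMeasure n)) :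
    ‖mulL 𝕜 n ψ v‖ ≤ ‖ψ‖ * ‖v‖ := by
  refine Lp.norm_le_mul_norm_of_ae_le_mul ?_
  filter_upwards [coeFn_mulL ψ v] with x hx
  rw [hx, norm_mul]
  gcongr
  exact ψ.norm_coe_le_norm x

end Mul

lemma ofRealL_mulL (ψ : C(Torus n, ℝ)) (v : L2Torus n) :
    ofRealL n (mulL ℝ n ψ v) =
      mulL ℂ n (ContinuousMap.comp ⟨Complex.ofReal, Complex.continuous_ofReal⟩ ψ)
        (ofRealL n v) := by
  refine Lp.ext ?_
  refine (coeFn_ofRealL _).trans ?_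
  refine EventuallyEq.trans ?_ (coeFn_mulL _ _).symm
  filter_upwards [coeFn_ofRealL v, coeFn_mulL ψ v] with x h1 h2
  rw [h1, h2]
  simp

lemma inner_ofRealL (v w : L2Torus n) :
    ⟪ofRealL n v, ofRealL n w⟫_ℂ = ((⟪v, w⟫_ℝ : ℝ) : ℂ) := by
  rw [L2.inner_def, L2.inner_def, ← integral_complex_ofReal]
  refine integral_congr_ae ?_
  filter_upwards [coeFn_ofRealL v, coeFn_ofRealL w] with x h1 h2
  rw [h1, h2]
  simp

lemma repr_mulL_mFourier (h : Fin n → ℤ) (v : L2TorusC n) (k : Fin n → ℤ) :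
    (torusBasis n).repr (mulL ℂ n (UnitAddTorus.mFourier h) v) k =
      (torusBasis n).repr v (k - h) := by
  rw [repr_torusBasis, repr_torusBasis]
  refine integral_congr_ae ?_
  filter_upwards [coeFn_mulL (UnitAddTorus.mFourier h) v] with x hx
  rw [hx, ← mul_assoc, ← UnitAddTorus.mFourier_add, neg_sub, sub_eq_neg_add]

lemma inner_toLp_eq (ψ : C(Torus n, ℝ)) (v : L2Torus n) :
    ⟪v, ContinuousMap.toLp 2 (torusMeasure n) ℝ ψ⟫_ℝ = ∫ x, v x * ψ x ∂torusMeasure n := by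
  rw [L2.inner_def]
  refine integral_congr_ae ?_
  filter_upwards [ContinuousMap.coeFn_toLp (p := 2) (𝕜 := ℝ) (torusMeasure n) ψ] with x hx
  rw [hx]
  simp [mul_comm]

lemma inner_mulL_eq (ψ : C(Torus n, ℝ)) (v w : L2Torus n) :
    ⟪v, mulL ℝ n ψ w⟫_ℝ = ∫ x, v x * w x * ψ x ∂torusMeasure n := by
  rw [L2.inner_def]
  refine integral_congr_ae ?_
  filter_upwards [coeFn_mulL ψ w] with x hx
  rw [hx]
  simp only [RCLike.inner_apply, conj_trivial]
  ring

lemma integrable_mul_continuousMap (ψ : C(Torus n, ℝ)) (v : L2Torus n) :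
    Integrable (fun x => v x * ψ x) (torusMeasure n) := by
  refine (L2.integrable_inner (𝕜 := ℝ) v (ContinuousMap.toLp 2 (torusMeasure n) ℝ ψ)).congr ?_
  filter_upwards [ContinuousMap.coeFn_toLp (p := 2) (𝕜 := ℝ) (torusMeasure n) ψ] with x hx
  rw [hx]
  simp [mul_comm]

lemma integrable_mul_mul_continuousMap (ψ : C(Torus n, ℝ)) (v w : L2Torus n) :
    Integrable (fun x => v x * w x * ψ x) (torusMeasure n) := by
  refine (L2.integrable_inner (𝕜 := ℝ) v (mulL ℝ n ψ w)).congr ?_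
  filter_upwards [coeFn_mulL ψ w] with x hx
  rw [hx]
  simp only [RCLike.inner_apply, conj_trivial]
  ring

end

/-! ### The symbol and the weak continuity of the quadratic forms `∫ ψ θ Tˡ[θ] dx` -/

section

variable {n : ℕ}

/-- Restriction of a symbol component to the integer frequencies. -/
def latticeSymbol (m : (Fin n → ℝ) → Fin n → ℂ) (l : Fin n) (k : Fin n → ℤ) : ℂ :=
  m (fun i => (k i : ℝ)) l

lemma norm_intCast (k : Fin n → ℤ) : ‖(fun i => (k i : ℝ))‖ = ‖k‖ := by
  simp only [Pi.norm_def, ← Int.norm_cast_real, nnnorm]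

lemma intCast_ne_zero {k : Fin n → ℤ} (hk : k ≠ 0) : (fun i => (k i : ℝ)) ≠ 0 := by
  rwa [← norm_ne_zero_iff, norm_intCast, norm_ne_zero_iff]

lemma IsSymbol.eq_normalize {m : (Fin n → ℝ) → Fin n → ℂ} (hm : IsSymbol m) {ξ : Fin n → ℝ}
    (hξ : ξ ≠ 0) : m ξ = m (‖ξ‖⁻¹ • ξ) :=
  (hm.homogeneous _ ξ (inv_pos.2 (norm_pos_iff.2 hξ)) hξ).symm

lemma normalize_mem_sphere {ξ : Fin n → ℝ} (hξ : ξ ≠ 0) :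
    ‖ξ‖⁻¹ • ξ ∈ Metric.sphere (0 : Fin n → ℝ) 1 := by
  rw [mem_sphere_zero_iff_norm, norm_smul, norm_inv, norm_norm,
    inv_mul_cancel₀ (norm_ne_zero_iff.2 hξ)]

lemma IsSymbol.continuousOn_sphere {m : (Fin n → ℝ) → Fin n → ℂ} (hm : IsSymbol m) :
    ContinuousOn m (Metric.sphere (0 : Fin n → ℝ) 1) := by
  refine hm.smooth.continuousOn.mono fun ξ hξ => ?_
  rintro rfl
  simp at hξ

lemma IsSymbol.exists_bound {m : (Fin n → ℝ) → Fin n → ℂ} (hm : IsSymbol m) :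
    ∃ C : ℝ, 0 ≤ C ∧ ∀ (l : Fin n) (k : Fin n → ℤ), ‖latticeSymbol m l k‖ ≤ C := by
  obtain ⟨C, hC⟩ := (isCompact_sphere (0 : Fin n → ℝ) 1).exists_bound_of_continuousOn
    hm.continuousOn_sphere
  refine ⟨max C ‖m 0‖, (norm_nonneg _).trans (le_max_right _ _), fun l k => ?_⟩
  refine (norm_le_pi_norm _ l).trans ?_
  rcases eq_or_ne k 0 with rfl | hk
  · refine le_trans (le_of_eq ?_) (le_max_right _ _)
    congr 2
    ext i
    simp
  · rw [hm.eq_normalize (intCast_ne_zero hk)]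
    exact (hC _ (normalize_mem_sphere (intCast_ne_zero hk))).trans (le_max_left _ _)

lemma latticeSymbol_neg {m : (Fin n → ℝ) → Fin n → ℂ} (hm : IsSymbol m) (l : Fin n)
    (k : Fin n → ℤ) : latticeSymbol m l (-k) = conj (latticeSymbol m l k) := by
  rw [latticeSymbol, latticeSymbol, ← hm.reality]
  congr 1
  ext i
  simp

lemma norm_normalize_sub_le {ξ η : Fin n → ℝ} (hξ : ξ ≠ 0) (hη : η ≠ 0) :
    ‖‖ξ‖⁻¹ • ξ - ‖η‖⁻¹ • η‖ ≤ 2 * ‖ξ - η‖ * ‖ξ‖⁻¹ := by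
  have hξ' := norm_pos_iff.2 hξ
  have hη' := norm_pos_iff.2 hη
  have : ‖ξ‖⁻¹ • ξ - ‖η‖⁻¹ • η
      = ‖ξ‖⁻¹ • (ξ - η) + ((‖ξ‖⁻¹ * (‖η‖ - ‖ξ‖)) * ‖η‖⁻¹) • η := by
    rw [smul_sub, sub_add, ← sub_smul]
    congr 2
    field_simp
    ring
  rw [this]
  refine (norm_add_le _ _).trans ?_
  rw [norm_smul, norm_smul, norm_mul, norm_mul, norm_inv, norm_inv, norm_norm, norm_norm,
    mul_assoc _ ‖η‖⁻¹, inv_mul_cancel₀ hη'.ne', mul_one]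
  have h := abs_norm_sub_norm_le η ξ
  rw [norm_sub_rev] at h
  rw [Real.norm_eq_abs]
  have := mul_le_mul_of_nonneg_left h (inv_nonneg.2 hξ'.le)
  linarith

/-- For an odd symbol the symmetrized kernel tends to zero along each diagonal: this is what makes
the commutator of `Tˡ` with a trigonometric monomial a compact operator. -/
lemma tendsto_latticeSymbol_add {m : (Fin n → ℝ) → Fin n → ℂ} (hm : IsSymbol m)
    (hodd : ∀ ξ : Fin n → ℝ, ξ ≠ 0 → m (-ξ) = -m ξ) (l : Fin n) (h : Fin n → ℤ) :
    Tendsto (fun k => latticeSymbol m l (k - h) + latticeSymbol m l (-k)) cofinite (𝓝 0) := by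
  have huc := (isCompact_sphere (0 : Fin n → ℝ) 1).uniformContinuousOn_of_continuous
    hm.continuousOn_sphere
  rw [Metric.uniformContinuousOn_iff] at huc
  rw [Metric.tendsto_nhds]
  intro ε hε
  obtain ⟨δ, hδ, H⟩ := huc ε hε
  have hinf : Tendsto (fun k : Fin n → ℤ => ‖k‖) cofinite atTop := by
    rw [← cocompact_eq_cofinite]
    exact tendsto_norm_cocompact_atTop
  have h2 : Tendsto (fun k : Fin n → ℤ => 2 * ‖h‖ * ‖k‖⁻¹) cofinite (𝓝 0) := by
    simpa using hinf.inv_tendsto_atTop.const_mul (2 * ‖h‖)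
  filter_upwards [h2.eventually (gt_mem_nhds hδ), (Set.finite_singleton 0).compl_mem_cofinite,
    (Set.finite_singleton h).compl_mem_cofinite] with k hk hk0 hkh
  have hk1 : (fun i => (k i : ℝ)) ≠ 0 := intCast_ne_zero hk0
  have hk2 : (fun i => ((k - h) i : ℝ)) ≠ 0 := intCast_ne_zero (sub_ne_zero.2 hkh)
  have hneg : (fun i => (((-k) i : ℤ) : ℝ)) = -(fun i => (k i : ℝ)) := by
    ext i
    simp
  rw [dist_zero_right, latticeSymbol, latticeSymbol, hneg, hodd _ hk1, Pi.neg_apply,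
    ← sub_eq_add_neg, ← Pi.sub_apply]
  refine (norm_le_pi_norm _ l).trans_lt ?_
  rw [← dist_eq_norm, dist_comm, hm.eq_normalize hk1, hm.eq_normalize hk2]
  refine H _ (normalize_mem_sphere hk1) _ (normalize_mem_sphere hk2) ?_
  rw [dist_eq_norm]
  refine (norm_normalize_sub_le hk1 hk2).trans_lt ?_
  have hsub : (fun i => (k i : ℝ)) - (fun i => ((k - h) i : ℝ)) = fun i => (h i : ℝ) := by
    ext i
    simp
  rw [hsub, norm_intCast, norm_intCast]
  exact hk

/-- The component `Tˡ` of the drift operator. -/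
def driftL {m : (Fin n → ℝ) → Fin n → ℂ} (hm : IsSymbol m) (l : Fin n) :
    L2Torus n →L[ℝ] L2Torus n :=
  multiplier (latticeSymbol m l) hm.exists_bound.choose_spec.1
    (hm.exists_bound.choose_spec.2 l)

lemma fourierCoeff_driftL {m : (Fin n → ℝ) → Fin n → ℂ} (hm : IsSymbol m) (l : Fin n)
    (v : L2Torus n) (k : Fin n → ℤ) :
    fourierCoeff (driftL hm l v) k = latticeSymbol m l k * fourierCoeff v k :=
  fourierCoeff_multiplier _ _ _ (latticeSymbol_neg hm l) v k

lemma isDrift_iff {m : (Fin n → ℝ) → Fin n → ℂ} (hm : IsSymbol m) (v : L2Torus n)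
    (u : Fin n → L2Torus n) : IsDrift m v u ↔ ∀ l, u l = driftL hm l v := by
  refine ⟨fun h l => eq_of_fourierCoeff_eq fun k => ?_, fun h l k => ?_⟩
  · rw [h, fourierCoeff_driftL, latticeSymbol]
  · rw [h, fourierCoeff_driftL, latticeSymbol]

/-- The quadratic form `θ ↦ ∫ ψ θ Tˡ[θ] dx`, for complex-valued continuous weights `ψ`. -/
def quadForm {m : (Fin n → ℝ) → Fin n → ℂ} (hm : IsSymbol m) (l : Fin n) (ψ : C(Torus n, ℂ))
    (v : L2Torus n) : ℂ :=
  ⟪ofRealL n v, mulL ℂ n ψ (ofRealL n (driftL hm l v))⟫_ℂ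

lemma hasSum_quadForm_mFourier {m : (Fin n → ℝ) → Fin n → ℂ} (hm : IsSymbol m) (l : Fin n)
    (h : Fin n → ℤ) (v : L2Torus n) :
    HasSum (fun k => (latticeSymbol m l (k - h) + latticeSymbol m l (-k)) / 2 *
      (conj (fourierCoeff v k) * fourierCoeff v (k - h)))
      (quadForm hm l (UnitAddTorus.mFourier h) v) := by
  have h1 := hasSum_conj_mul_fourierCoeff (ofRealL n v)
    (mulL ℂ n (UnitAddTorus.mFourier h) (ofRealL n (driftL hm l v)))
  simp only [repr_mulL_mFourier, ← fourierCoeff_eq_repr, fourierCoeff_driftL] at h1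
  -- the reflection `k ↦ h - k` exchanges the two Fourier coefficients in each term
  have h2 := (Equiv.subLeft h).hasSum_iff.2 h1
  have h3 := (h1.add h2).div_const 2
  rw [← quadForm, add_self_div_two] at h3
  refine h3.congr_fun fun k => ?_
  have e1 : h - k - h = -k := by abel
  have e2 : h - k = -(k - h) := by abel
  simp only [Function.comp, Equiv.subLeft_apply]
  rw [e1, e2, fourierCoeff_neg v (k - h), fourierCoeff_neg v k, Complex.conj_conj]
  ring

/-- The change from `v` to `w` of the quadratic monomial in the Fourier coefficients of
index `q.1` and `q.2`. -/
def pairDiff (v w : L2Torus n) (q : (Fin n → ℤ) × (Fin n → ℤ)) : ℝ :=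
  ‖conj (fourierCoeff v q.1) * fourierCoeff v q.2 - conj (fourierCoeff w q.1) * fourierCoeff w q.2‖

lemma pairDiff_nonneg (v w : L2Torus n) (q : (Fin n → ℤ) × (Fin n → ℤ)) : 0 ≤ pairDiff v w q :=
  norm_nonneg _

/-- Weak continuity, uniform over the weights `ψ ∈ Ψ`, of the quadratic forms `∫ ψ θ Tˡ[θ] dx` on
bounded sets: up to an arbitrarily small multiple of the squared norms, they are controlled by
finitely many Fourier coefficients. -/
def IsFinitelyControlled {m : (Fin n → ℝ) → Fin n → ℂ} (hm : IsSymbol m) (l : Fin n)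
    (Ψ : Set C(Torus n, ℂ)) : Prop :=
  ∀ ε : ℝ, 0 < ε → ∃ (S : Finset ((Fin n → ℤ) × (Fin n → ℤ))) (C : ℝ), 0 ≤ C ∧
    ∀ ψ ∈ Ψ, ∀ v w : L2Torus n, ‖quadForm hm l ψ v - quadForm hm l ψ w‖ ≤
      ε * (‖v‖ ^ 2 + ‖w‖ ^ 2) + C * ∑ q ∈ S, pairDiff v w q

section

variable {m : (Fin n → ℝ) → Fin n → ℂ} (hm : IsSymbol m) (l : Fin n)

lemma quadForm_add (ψ χ : C(Torus n, ℂ)) (v : L2Torus n) :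
    quadForm hm l (ψ + χ) v = quadForm hm l ψ v + quadForm hm l χ v := by
  simp [quadForm, inner_add_right]

lemma quadForm_sub (ψ χ : C(Torus n, ℂ)) (v : L2Torus n) :
    quadForm hm l (ψ - χ) v = quadForm hm l ψ v - quadForm hm l χ v := by
  simp [quadForm, inner_sub_right]

lemma quadForm_smul (c : ℂ) (ψ : C(Torus n, ℂ)) (v : L2Torus n) :
    quadForm hm l (c • ψ) v = c * quadForm hm l ψ v := by
  simp [quadForm, inner_smul_right]

lemma norm_quadForm_le (ψ : C(Torus n, ℂ)) (v : L2Torus n) :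
    ‖quadForm hm l ψ v‖ ≤ ‖ψ‖ * (‖driftL hm l‖ * ‖v‖ ^ 2) := by
  refine (norm_inner_le_norm _ _).trans ?_
  calc _ ≤ ‖v‖ * (‖ψ‖ * (‖driftL hm l‖ * ‖v‖)) := by
        rw [norm_ofRealL]
        gcongr
        refine (norm_mulL_le _ _).trans ?_
        rw [norm_ofRealL]
        gcongr
        exact (driftL hm l).le_opNorm v
    _ = _ := by ring

lemma norm_quadForm_mFourier_sub_le (h : Fin n → ℤ) {ε : ℝ} (hε : 0 ≤ ε)
    {S : Finset (Fin n → ℤ)}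
    (hS : ∀ k ∉ S, ‖latticeSymbol m l (k - h) + latticeSymbol m l (-k)‖ ≤ ε) (v : L2Torus n) :
    ‖quadForm hm l (UnitAddTorus.mFourier h) v - ∑ k ∈ S,
      (latticeSymbol m l (k - h) + latticeSymbol m l (-k)) / 2 *
      (conj (fourierCoeff v k) * fourierCoeff v (k - h))‖ ≤ ε * ‖v‖ ^ 2 := by
  classical
  have h1 := hasSum_quadForm_mFourier hm l h v
  set F : (Fin n → ℤ) → ℂ := fun k => (latticeSymbol m l (k - h) + latticeSymbol m l (-k)) / 2 *
      (conj (fourierCoeff v k) * fourierCoeff v (k - h)) with hF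
  have h2 : HasSum (fun k => if k ∈ S then F k else 0) (∑ k ∈ S, F k) := by
    rw [← Finset.sum_congr rfl fun k hk => if_pos (t := F k) (e := (0 : ℂ)) hk]
    exact hasSum_sum_of_ne_finset_zero fun k hk => if_neg hk
  have h3 := h1.sub h2
  have h4 := hasSum_sq_fourierCoeff v
  have h5 : HasSum (fun k => ‖fourierCoeff v (k - h)‖ ^ 2) (‖v‖ ^ 2) :=
    (Equiv.subRight h).hasSum_iff.2 h4
  have h6 := (h4.add h5).mul_left (ε / 2)
  have h7 := tsum_of_norm_bounded h6 (f := fun k => F k - if k ∈ S then F k else 0) fun k => ?_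
  · rw [h3.tsum_eq] at h7
    refine h7.trans (le_of_eq ?_)
    ring
  · by_cases hk : k ∈ S
    · simp only [hk, if_true, sub_self, norm_zero]
      positivity
    · simp only [hk, if_false, sub_zero, hF, norm_mul, norm_div, RCLike.norm_conj]
      have ha := hS k hk
      have h2 : ‖(2 : ℂ)‖ = 2 := by simp
      rw [h2]
      have hab := two_mul_le_add_sq ‖fourierCoeff v k‖ ‖fourierCoeff v (k - h)‖
      calc _ ≤ ε / 2 * (‖fourierCoeff v k‖ * ‖fourierCoeff v (k - h)‖) := by gcongr
        _ ≤ _ := by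
          gcongr
          nlinarith [norm_nonneg (fourierCoeff v k), norm_nonneg (fourierCoeff v (k - h))]

lemma isFinitelyControlled_mFourier
    (hodd : ∀ ξ : Fin n → ℝ, ξ ≠ 0 → m (-ξ) = -m ξ) (h : Fin n → ℤ) :
    IsFinitelyControlled hm l {UnitAddTorus.mFourier h} := by
  classical
  intro ε hε
  have h1 := (tendsto_latticeSymbol_add hm hodd l h).norm
  rw [norm_zero] at h1
  have hfin : {k | ¬ ‖latticeSymbol m l (k - h) + latticeSymbol m l (-k)‖ < ε}.Finite :=
    h1.eventually (gt_mem_nhds hε)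
  obtain ⟨C, hC, hbound⟩ := hm.exists_bound
  have hS : ∀ k ∉ hfin.toFinset, ‖latticeSymbol m l (k - h) + latticeSymbol m l (-k)‖ ≤ ε := by
    intro k hk
    simp only [Set.Finite.mem_toFinset, Set.mem_ofPred_eq, not_not] at hk
    exact hk.le
  refine ⟨hfin.toFinset.image fun k => (k, k - h), C, hC, ?_⟩
  rintro _ rfl v w
  have hv := norm_quadForm_mFourier_sub_le hm l h hε.le hS v
  have hw := norm_quadForm_mFourier_sub_le hm l h hε.le hS w
  rw [Finset.sum_image fun a _ b _ hab => (Prod.ext_iff.1 hab).1, Finset.mul_sum]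
  set Q := quadForm hm l (UnitAddTorus.mFourier h)
  set P : L2Torus n → ℂ := fun v => ∑ k ∈ hfin.toFinset,
      (latticeSymbol m l (k - h) + latticeSymbol m l (-k)) / 2 *
      (conj (fourierCoeff v k) * fourierCoeff v (k - h))
  have hP : ‖P v - P w‖ ≤ ∑ k ∈ hfin.toFinset, C * pairDiff v w (k, k - h) := by
    rw [← Finset.sum_sub_distrib]
    refine norm_sum_le_of_le _ fun k _ => ?_
    rw [← mul_sub, norm_mul]
    refine mul_le_mul_of_nonneg_right ?_ (norm_nonneg _)
    rw [norm_div, Complex.norm_ofNat]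
    linarith [norm_add_le (latticeSymbol m l (k - h)) (latticeSymbol m l (-k)),
      hbound l (k - h), hbound l (-k)]
  calc ‖Q v - Q w‖ = ‖(Q v - P v) - (Q w - P w) + (P v - P w)‖ := by
        congr 1
        ring
    _ ≤ ‖Q v - P v‖ + ‖Q w - P w‖ + ‖P v - P w‖ :=
        (norm_add_le _ _).trans (add_le_add_left (norm_sub_le _ _) _)
    _ ≤ _ := by
        rw [mul_add]
        gcongr

variable {hm l}

lemma IsFinitelyControlled.mono {Ψ Ψ' : Set C(Torus n, ℂ)} (h : IsFinitelyControlled hm l Ψ)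
    (hsub : Ψ' ⊆ Ψ) : IsFinitelyControlled hm l Ψ' := by
  intro ε hε
  obtain ⟨S, C, hC, H⟩ := h ε hε
  exact ⟨S, C, hC, fun ψ hψ => H ψ (hsub hψ)⟩

lemma mul_sum_pairDiff_mono {S S' : Finset ((Fin n → ℤ) × (Fin n → ℤ))} (hS : S ⊆ S') {C C' : ℝ}
    (hC : 0 ≤ C) (hCC' : C ≤ C') (v w : L2Torus n) :
    C * ∑ q ∈ S, pairDiff v w q ≤ C' * ∑ q ∈ S', pairDiff v w q := by
  refine mul_le_mul hCC' (Finset.sum_le_sum_of_subset_of_nonneg hS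
    fun q _ _ => pairDiff_nonneg _ _ _) (Finset.sum_nonneg fun q _ => pairDiff_nonneg _ _ _)
    (hC.trans hCC')

lemma IsFinitelyControlled.union {Ψ Ψ' : Set C(Torus n, ℂ)} (h : IsFinitelyControlled hm l Ψ)
    (h' : IsFinitelyControlled hm l Ψ') : IsFinitelyControlled hm l (Ψ ∪ Ψ') := by
  classical
  intro ε hε
  obtain ⟨S, C, hC, H⟩ := h ε hε
  obtain ⟨S', C', hC', H'⟩ := h' ε hε
  refine ⟨S ∪ S', max C C', hC.trans (le_max_left _ _), ?_⟩
  rintro ψ (hψ | hψ) v w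
  · exact (H ψ hψ v w).trans (add_le_add_right
      (mul_sum_pairDiff_mono Finset.subset_union_left hC (le_max_left _ _) v w) _)
  · exact (H' ψ hψ v w).trans (add_le_add_right
      (mul_sum_pairDiff_mono Finset.subset_union_right hC' (le_max_right _ _) v w) _)

lemma IsFinitelyControlled.add {ψ χ : C(Torus n, ℂ)} (h : IsFinitelyControlled hm l {ψ})
    (h' : IsFinitelyControlled hm l {χ}) : IsFinitelyControlled hm l {ψ + χ} := by
  intro ε hε
  obtain ⟨S, C, hC, H⟩ := (h.union h') (ε / 2) (half_pos hε)
  refine ⟨S, C + C, add_nonneg hC hC, ?_⟩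
  rintro _ rfl v w
  have h1 := H ψ (by simp) v w
  have h2 := H χ (by simp) v w
  rw [quadForm_add, quadForm_add, add_sub_add_comm]
  refine (norm_add_le _ _).trans ((add_le_add h1 h2).trans (le_of_eq ?_))
  ring

lemma IsFinitelyControlled.smul {ψ : C(Torus n, ℂ)} (h : IsFinitelyControlled hm l {ψ}) (c : ℂ) :
    IsFinitelyControlled hm l {c • ψ} := by
  intro ε hε
  have hc : 0 < ‖c‖ + 1 := by positivity
  obtain ⟨S, C, hC, H⟩ := h (ε / (‖c‖ + 1)) (div_pos hε hc)
  refine ⟨S, (‖c‖ + 1) * C, by positivity, ?_⟩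
  rintro _ rfl v w
  have h1 := H ψ rfl v w
  rw [quadForm_smul, quadForm_smul, ← mul_sub, norm_mul]
  calc _ ≤ (‖c‖ + 1) * (ε / (‖c‖ + 1) * (‖v‖ ^ 2 + ‖w‖ ^ 2) + C * ∑ q ∈ S, pairDiff v w q) := by
        gcongr
        linarith
    _ = _ := by
        field_simp

/-- A set of weights lying, for every `δ > 0`, within `δ` of a controlled set is controlled: the
form is bounded by a multiple of `‖ψ‖ ‖θ‖²`, so that `δ` is absorbed into `ε`. -/
lemma IsFinitelyControlled.of_dist_lt {Ψ : Set C(Torus n, ℂ)}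
    (h : ∀ δ : ℝ, 0 < δ → ∃ Ψ', IsFinitelyControlled hm l Ψ' ∧ ∀ ψ ∈ Ψ, ∃ χ ∈ Ψ', dist ψ χ ≤ δ) :
    IsFinitelyControlled hm l Ψ := by
  intro ε hε
  set D := ‖driftL hm l‖ + 1
  have hD : 0 < D := by positivity
  obtain ⟨Ψ', hΨ', H'⟩ := h (ε / 2 / D) (by positivity)
  obtain ⟨S, C, hC, H⟩ := hΨ' (ε / 2) (half_pos hε)
  refine ⟨S, C, hC, fun ψ hψ v w => ?_⟩
  obtain ⟨χ, hχ, hd⟩ := H' ψ hψ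
  have key : ∀ v, ‖quadForm hm l (ψ - χ) v‖ ≤ ε / 2 * ‖v‖ ^ 2 := by
    intro v
    refine (norm_quadForm_le hm l _ v).trans ?_
    rw [← dist_eq_norm]
    calc _ ≤ ε / 2 / D * (D * ‖v‖ ^ 2) := by
          gcongr
          simp [D]
      _ = _ := by field_simp
  have e : quadForm hm l ψ v - quadForm hm l ψ w = quadForm hm l (ψ - χ) v
      - quadForm hm l (ψ - χ) w + (quadForm hm l χ v - quadForm hm l χ w) := by
    rw [quadForm_sub, quadForm_sub]
    ring
  rw [e]
  refine (norm_add_le _ _).trans ((add_le_add ((norm_sub_le _ _).trans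
    (add_le_add (key v) (key w))) (H χ hχ v w)).trans (le_of_eq ?_))
  ring

lemma isFinitelyControlled_singleton (hodd : ∀ ξ : Fin n → ℝ, ξ ≠ 0 → m (-ξ) = -m ξ)
    (ψ : C(Torus n, ℂ)) : IsFinitelyControlled hm l {ψ} := by
  have hspan : ∀ χ ∈ Submodule.span ℂ (Set.range (UnitAddTorus.mFourier (d := Fin n))),
      IsFinitelyControlled hm l {χ} := by
    intro χ hχ
    induction hχ using Submodule.span_induction with
    | mem x hx =>
      obtain ⟨h, rfl⟩ := hx
      exact isFinitelyControlled_mFourier hm l hodd h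
    | zero =>
      have := (isFinitelyControlled_mFourier hm l hodd 0).smul (0 : ℂ)
      rwa [zero_smul ℂ (UnitAddTorus.mFourier (d := Fin n) 0)] at this
    | add x y _ _ hx hy => exact hx.add hy
    | smul c x _ hx => exact hx.smul c
  have hψ : ψ ∈ (Submodule.span ℂ (Set.range (UnitAddTorus.mFourier (d := Fin n)))
      ).topologicalClosure := by
    rw [UnitAddTorus.span_mFourier_closure_eq_top]
    trivial
  refine .of_dist_lt fun δ hδ => ?_
  obtain ⟨χ, hχ, hd⟩ := Metric.mem_closure_iff.1 hψ δ hδ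
  refine ⟨{χ}, hspan χ hχ, ?_⟩
  rintro _ rfl
  exact ⟨χ, rfl, hd.le⟩

/-- The quadratic forms `∫ ψ θ Tˡ[θ] dx` are weakly continuous on bounded sets, uniformly over
compact sets of weights `ψ`. -/
lemma isFinitelyControlled_of_isCompact (hodd : ∀ ξ : Fin n → ℝ, ξ ≠ 0 → m (-ξ) = -m ξ)
    {Ψ : Set C(Torus n, ℂ)} (hΨ : IsCompact Ψ) : IsFinitelyControlled hm l Ψ := by
  refine .of_dist_lt fun δ hδ => ?_
  obtain ⟨t, hsub, htfin, ht⟩ := hΨ.finite_cover_balls hδ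
  refine ⟨t, ?_, fun ψ hψ => ?_⟩
  · clear ht hsub
    induction t, htfin using Set.Finite.induction_on with
    | empty => exact (isFinitelyControlled_singleton hodd 0).mono (Set.empty_subset _)
    | insert _ _ h => exact (isFinitelyControlled_singleton hodd _).union h
  · obtain ⟨χ, hχ, hd⟩ := Set.mem_iUnion₂.1 (ht hψ)
    exact ⟨χ, hχ, hd.le⟩

end

end

/-! ### Test functions -/

section

variable {n : ℕ}

/-- The projection `ℝⁿ → 𝕋ⁿ`. -/
def torusProj (n : ℕ) (y : Fin n → ℝ) : Torus n := fun i => ((y i : ℝ) : UnitAddCircle)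

lemma isOpenQuotientMap_torusProj (n : ℕ) : IsOpenQuotientMap (torusProj n) :=
  IsOpenQuotientMap.piMap fun _ => QuotientAddGroup.isOpenQuotientMap_mk

lemma torusProj_add_single (y : Fin n → ℝ) (l : Fin n) (s : ℝ) :
    torusProj n y + Pi.single l (s : UnitAddCircle) = torusProj n (y + s • Pi.single l 1) := by
  ext i
  rcases eq_or_ne i l with rfl | h
  · simp [torusProj]
  · simp [torusProj, h]

/-- A function on `ℝ × 𝕋ⁿ` is continuous as soon as its periodic lift is. -/
lemma continuous_of_lift {F : ℝ × Torus n → ℝ}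
    (h : Continuous fun z : ℝ × (Fin n → ℝ) => F (z.1, torusProj n z.2)) : Continuous F :=
  ((IsOpenQuotientMap.id.prodMap (isOpenQuotientMap_torusProj n)).isQuotientMap).continuous_iff.2 h

section

variable {I : Set ℝ} {φ : ℝ → Torus n → ℝ} (hφ : IsTestFunction I φ)
include hφ

lemma IsTestFunction.continuous_dt : Continuous fun z : ℝ × Torus n => dt φ z.1 z.2 := by
  refine continuous_of_lift ?_
  have hs := hφ.smooth
  set Φ : ℝ × (Fin n → ℝ) → ℝ := fun z => φ z.1 (fun i => ((z.2 i : ℝ) : UnitAddCircle))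
  have : (fun z : ℝ × (Fin n → ℝ) => dt φ z.1 (torusProj n z.2))
      = fun z => fderiv ℝ Φ z (1, 0) := by
    ext ⟨t, y⟩
    have h1 : HasDerivAt (fun s : ℝ => (s, y)) ((1 : ℝ), (0 : Fin n → ℝ)) t :=
      (hasDerivAt_id t).prodMk (hasDerivAt_const t y)
    exact ((hs.differentiable (by simp) (t, y)).hasFDerivAt.comp_hasDerivAt t h1).deriv
  rw [this]
  exact (hs.continuous_fderiv (by simp)).clm_apply continuous_const

lemma IsTestFunction.continuous_dx (l : Fin n) :
    Continuous fun z : ℝ × Torus n => dx l φ z.1 z.2 := by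
  refine continuous_of_lift ?_
  have hs := hφ.smooth
  set Φ : ℝ × (Fin n → ℝ) → ℝ := fun z => φ z.1 (fun i => ((z.2 i : ℝ) : UnitAddCircle))
  have : (fun z : ℝ × (Fin n → ℝ) => dx l φ z.1 (torusProj n z.2))
      = fun z => fderiv ℝ Φ z (0, Pi.single l 1) := by
    ext ⟨t, y⟩
    have h1 : HasDerivAt (fun s : ℝ => (t, y + s • Pi.single l (1 : ℝ)))
        ((0 : ℝ), (Pi.single l 1 : Fin n → ℝ)) 0 := by
      refine (hasDerivAt_const _ t).prodMk ?_
      simpa using ((hasDerivAt_id (0 : ℝ)).smul_const (Pi.single l (1 : ℝ))).const_add y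
    have h2 : HasFDerivAt Φ (fderiv ℝ Φ (t, y)) (t, y + (0 : ℝ) • Pi.single l (1 : ℝ)) := by
      simpa using (hs.differentiable (by simp) (t, y)).hasFDerivAt
    have h3 := (h2.comp_hasDerivAt (0 : ℝ) h1).deriv
    rw [← h3, dx]
    congr 1
    ext s
    simp only [torusProj_add_single]
    rfl
  rw [this]
  exact (hs.continuous_fderiv (by simp)).clm_apply continuous_const

/-- The time derivative of a test function, as a continuous function of time with values
in `C(𝕋ⁿ)`. -/
def IsTestFunction.dtC : C(ℝ, C(Torus n, ℝ)) := ContinuousMap.curry ⟨_, hφ.continuous_dt⟩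

/-- A space derivative of a test function, as a continuous function of time with values
in `C(𝕋ⁿ)`. -/
def IsTestFunction.dxC (l : Fin n) : C(ℝ, C(Torus n, ℝ)) :=
  ContinuousMap.curry ⟨_, hφ.continuous_dx l⟩

lemma IsTestFunction.dtC_apply (t : ℝ) (x : Torus n) : hφ.dtC t x = dt φ t x := rfl

lemma IsTestFunction.dxC_apply (l : Fin n) (t : ℝ) (x : Torus n) :
    hφ.dxC l t x = dx l φ t x := rfl

lemma IsTestFunction.exists_support_derivatives :
    ∃ K : Set ℝ, IsCompact K ∧ K ⊆ I ∧ (∀ t ∉ K, hφ.dtC t = 0) ∧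
      ∀ l, ∀ t ∉ K, hφ.dxC l t = 0 := by
  obtain ⟨K, hK, hKI, h0⟩ := hφ.compactSupport
  refine ⟨K, hK, hKI, fun t ht => ?_, fun l t ht => ?_⟩
  · ext x
    have : (fun s => φ s x) =ᶠ[𝓝 t] fun _ => 0 := by
      filter_upwards [hK.isClosed.isOpen_compl.mem_nhds ht] with s hs
      exact h0 s hs x
    exact this.deriv_eq.trans (deriv_const _ _)
  · ext x
    have : (fun s : ℝ => φ t (x + Pi.single l (s : UnitAddCircle))) = fun _ => 0 := by
      ext s
      exact h0 t ht _
    rw [hφ.dxC_apply, dx, this]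
    exact deriv_const _ _

end

/-- A function on the torus is smooth if its periodic lift is. -/
def IsTorusSmooth (w : C(Torus n, ℝ)) : Prop := ContDiff ℝ ∞ fun y => w (torusProj n y)

lemma contDiff_mFourier (k : Fin n → ℤ) :
    ContDiff ℝ ∞ fun y : Fin n → ℝ => UnitAddTorus.mFourier k (torusProj n y) := by
  simp only [UnitAddTorus.mFourier, ContinuousMap.coe_mk, torusProj, fourier_coe_apply]
  refine contDiff_prod fun i _ => ?_
  refine ContDiff.cexp ?_
  have : ContDiff ℝ ∞ fun y : Fin n → ℝ => ((y i : ℝ) : ℂ) :=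
    Complex.ofRealCLM.contDiff.comp (contDiff_apply ℝ ℝ i)
  fun_prop

/-- Real part of the character of frequency `k`. -/
def reChar (k : Fin n → ℤ) : C(Torus n, ℝ) :=
  ContinuousMap.comp ⟨Complex.re, Complex.continuous_re⟩ (UnitAddTorus.mFourier k)

/-- Imaginary part of the character of frequency `k`. -/
def imChar (k : Fin n → ℤ) : C(Torus n, ℝ) :=
  ContinuousMap.comp ⟨Complex.im, Complex.continuous_im⟩ (UnitAddTorus.mFourier k)

lemma isTorusSmooth_reChar (k : Fin n → ℤ) : IsTorusSmooth (reChar k) :=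
  Complex.reCLM.contDiff.comp (contDiff_mFourier k)

lemma isTorusSmooth_imChar (k : Fin n → ℤ) : IsTorusSmooth (imChar k) :=
  Complex.imCLM.contDiff.comp (contDiff_mFourier k)

lemma isTestFunction_mul {I : Set ℝ} {χ : ℝ → ℝ} (hχ : ContDiff ℝ ∞ χ) {K : Set ℝ}
    (hK : IsCompact K) (hKI : K ⊆ I) (h0 : ∀ t ∉ K, χ t = 0) {w : C(Torus n, ℝ)}
    (hw : IsTorusSmooth w) : IsTestFunction I fun t x => χ t * w x where
  smooth := (hχ.comp contDiff_fst).mul (hw.comp contDiff_snd)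
  compactSupport := ⟨K, hK, hKI, fun t ht x => by rw [h0 t ht, zero_mul]⟩

/-- The partial derivative of a function on the torus. -/
def torusDeriv (w : C(Torus n, ℝ)) (l : Fin n) (x : Torus n) : ℝ :=
  deriv (fun s : ℝ => w (x + Pi.single l (s : UnitAddCircle))) 0

lemma dx_mul (χ : ℝ → ℝ) (w : C(Torus n, ℝ)) (l : Fin n) (t : ℝ) (x : Torus n) :
    dx l (fun t x => χ t * w x) t x = χ t * torusDeriv w l x := by
  simp only [dx, torusDeriv]
  exact deriv_const_mul_field _

lemma dt_mul (χ : ℝ → ℝ) (w : C(Torus n, ℝ)) (t : ℝ) (x : Torus n) :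
    dt (fun t x => χ t * w x) t x = deriv χ t * w x := by
  simp only [dt]
  exact deriv_mul_const_field _

lemma IsTorusSmooth.exists_deriv {w : C(Torus n, ℝ)} (hw : IsTorusSmooth w) :
    ∃ w' : Fin n → C(Torus n, ℝ), ∀ l x, w' l x = torusDeriv w l x := by
  let χ : ContDiffBump (0 : ℝ) := ⟨1, 2, one_pos, one_lt_two⟩
  have hφ : IsTestFunction Set.univ fun t x => χ t * w x :=
    isTestFunction_mul χ.contDiff (isCompact_closedBall (0 : ℝ) 2) (Set.subset_univ _)
      (fun t ht => χ.zero_of_le_dist (le_of_lt (by simpa using ht))) hw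
  refine ⟨fun l => hφ.dxC l 0, fun l x => ?_⟩
  rw [hφ.dxC_apply, dx_mul, χ.one_of_mem_closedBall (by simp [χ]), one_mul]

lemma fourierCoeff_eq_inner (v : L2Torus n) (k : Fin n → ℤ) :
    fourierCoeff v k =
      (⟪v, ContinuousMap.toLp 2 (torusMeasure n) ℝ (reChar (-k))⟫_ℝ : ℂ) +
      (⟪v, ContinuousMap.toLp 2 (torusMeasure n) ℝ (imChar (-k))⟫_ℝ : ℂ) * Complex.I := by
  have hre := integrable_mul_continuousMap (reChar (-k)) v
  have him := integrable_mul_continuousMap (imChar (-k)) v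
  rw [inner_toLp_eq, inner_toLp_eq, fourierCoeff_eq_integral, ← integral_complex_ofReal,
    ← integral_complex_ofReal, ← integral_mul_const, ← integral_add hre.ofReal]
  · refine integral_congr_ae (Eventually.of_forall fun x => ?_)
    change UnitAddTorus.mFourier (-k) x * (v x : ℂ) =
      ((v x * (UnitAddTorus.mFourier (-k) x).re : ℝ) : ℂ) +
      ((v x * (UnitAddTorus.mFourier (-k) x).im : ℝ) : ℂ) * Complex.I
    conv_lhs => rw [← Complex.re_add_im (UnitAddTorus.mFourier (-k) x)]
    push_cast
    ring
  · exact him.ofReal.mul_const _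

end

/-! ### Mollification in time -/

section

/-- The standard mollifier of width `ε` on the line. -/
def mollifier {ε : ℝ} (hε : 0 < ε) (s : ℝ) : ℝ :=
  (⟨ε / 2, ε, half_pos hε, half_lt_self hε⟩ : ContDiffBump (0 : ℝ)).normed volume s

section

variable {ε : ℝ} (hε : 0 < ε)

lemma contDiff_mollifier : ContDiff ℝ ∞ (mollifier hε) := ContDiffBump.contDiff_normed _

lemma mollifier_nonneg (s : ℝ) : 0 ≤ mollifier hε s := ContDiffBump.nonneg_normed _ _

lemma integral_mollifier_sub (t : ℝ) : ∫ s, mollifier hε (t - s) = 1 := by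
  rw [integral_sub_left_eq_self (mollifier hε)]
  exact ContDiffBump.integral_normed _

lemma integrable_mollifier_sub (t : ℝ) : Integrable fun s => mollifier hε (t - s) :=
  Integrable.comp_sub_left (ContDiffBump.integrable_normed _) t

lemma mollifier_sub_eq_zero {t s : ℝ} (h : ε ≤ |t - s|) : mollifier hε (t - s) = 0 := by
  have : t - s ∉ Function.support (mollifier hε) := by
    unfold mollifier
    rw [ContDiffBump.support_normed_eq]
    simpa using h
  simpa using this

/-- The average of `g` against the mollifier of width `ε` centred at `t`. -/
def mollify (g : ℝ → ℝ) (t : ℝ) : ℝ := ∫ s, g s * mollifier hε (t - s)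

lemma mollify_eq_convolution (g : ℝ → ℝ) (t : ℝ) :
    mollify hε g t = convolution (mollifier hε) g (ContinuousLinearMap.lsmul ℝ ℝ) volume t := by
  rw [convolution_eq_swap]
  refine integral_congr_ae (Eventually.of_forall fun s => ?_)
  simp [mul_comm]

lemma ae_tendsto_mollify {g : ℝ → ℝ} (hg : LocallyIntegrable g) :
    ∀ᵐ t, Tendsto (fun j : ℕ => mollify (ε := 1 / ((j : ℝ) + 1)) Nat.one_div_pos_of_nat g t) atTop
      (𝓝 (g t)) := by
  have := ContDiffBump.ae_convolution_tendsto_right_of_locallyIntegrable (μ := volume) (K := 2)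
    (φ := fun j : ℕ => (⟨1 / ((j : ℝ) + 1) / 2, 1 / ((j : ℝ) + 1), half_pos Nat.one_div_pos_of_nat,
      half_lt_self Nat.one_div_pos_of_nat⟩ : ContDiffBump (0 : ℝ)))
    (l := atTop) tendsto_one_div_add_atTop_nhds_zero_nat
    (Eventually.of_forall fun j => by simp only; linarith) hg
  filter_upwards [this] with t ht
  simp only [mollify_eq_convolution]
  exact ht

end

/-- The primitive of a mollifier centred at `t`, starting from `t - ε`. -/
def mollifierPrimitive (ε : ℝ) {δ : ℝ} (hδ : 0 < δ) (t s : ℝ) : ℝ :=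
  ∫ r in (t - ε)..s, mollifier hδ (t - r)

section

variable {ε δ : ℝ} (hδ : 0 < δ) (t : ℝ)

lemma hasDerivAt_mollifierPrimitive (s : ℝ) :
    HasDerivAt (mollifierPrimitive ε hδ t) (mollifier hδ (t - s)) s := by
  have hc : Continuous fun r => mollifier hδ (t - r) :=
    (contDiff_mollifier hδ).continuous.comp (by fun_prop)
  exact intervalIntegral.integral_hasDerivAt_right (hc.intervalIntegrable _ _)
    hc.stronglyMeasurable.stronglyMeasurableAtFilter hc.continuousAt

lemma contDiff_mollifierPrimitive : ContDiff ℝ ∞ (mollifierPrimitive ε hδ t) := by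
  rw [contDiff_infty_iff_deriv]
  refine ⟨fun s => (hasDerivAt_mollifierPrimitive hδ t s).differentiableAt, ?_⟩
  have : deriv (mollifierPrimitive ε hδ t) = fun s => mollifier hδ (t - s) := by
    ext s
    exact (hasDerivAt_mollifierPrimitive hδ t s).deriv
  rw [this]
  exact (contDiff_mollifier hδ).comp (contDiff_const.sub contDiff_id)

variable {t}

lemma mollifierPrimitive_eq_zero (hle : δ ≤ ε) {s : ℝ} (hs : s ≤ t - ε) :
    mollifierPrimitive ε hδ t s = 0 := by
  refine intervalIntegral.integral_zero_ae (Eventually.of_forall fun r hr => ?_)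
  rw [Set.uIoc_of_ge hs] at hr
  refine mollifier_sub_eq_zero hδ ?_
  rw [le_abs]
  left
  linarith [hr.2]

lemma mollifierPrimitive_eq_one (hle : δ ≤ ε) {s : ℝ} (hs : t + ε ≤ s) :
    mollifierPrimitive ε hδ t s = 1 := by
  rw [← integral_mollifier_sub hδ t]
  refine intervalIntegral.integral_eq_integral_of_support_subset fun r hr => ?_
  by_contra h
  refine hr (mollifier_sub_eq_zero hδ ?_)
  rw [Set.mem_Ioc, not_and_or, not_lt, not_le] at h
  rw [le_abs]
  rcases h with h | h
  · left; linarith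
  · right; linarith

lemma mollifierPrimitive_mem_Icc {s : ℝ} (hs : t - ε ≤ s) :
    mollifierPrimitive ε hδ t s ∈ Set.Icc (0 : ℝ) 1 := by
  rw [mollifierPrimitive, intervalIntegral.integral_of_le hs]
  refine ⟨integral_nonneg fun r => mollifier_nonneg hδ _, ?_⟩
  rw [← integral_mollifier_sub hδ t]
  exact setIntegral_le_integral (integrable_mollifier_sub hδ t)
    (Eventually.of_forall fun r => mollifier_nonneg hδ _)

end

/-- A quantitative weak form of `g' ∈ L^r_loc(I)`, `r > 1`: for test functions `χ` with values in
`[-1, 1]` and support in `[a, b] ⊆ I`, the pairing `∫ g χ'` is at most `M (b - a) ^ α`. -/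
def HasWeakHolderBound (I : Set ℝ) (M α : ℝ) (g : ℝ → ℝ) : Prop :=
  ∀ (a b : ℝ) (χ : ℝ → ℝ), a < b → Set.Icc a b ⊆ I → ContDiff ℝ ∞ χ →
    (∀ s ∉ Set.Icc a b, χ s = 0) → (∀ s, |χ s| ≤ 1) → |∫ s, g s * deriv χ s| ≤ M * (b - a) ^ α

lemma integrable_mul_mollifier {g : ℝ → ℝ} (hg : LocallyIntegrable g) {ε : ℝ} (hε : 0 < ε)
    (t : ℝ) : Integrable fun s => g s * mollifier hε (t - s) := by
  have := hg.integrable_smul_left_of_hasCompactSupport (g := fun s => mollifier hε (t - s))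
    ((contDiff_mollifier hε).continuous.comp (by fun_prop)) ?_
  · simpa [mul_comm] using this
  · refine HasCompactSupport.intro (isCompact_closedBall t ε) fun s hs => ?_
    refine mollifier_sub_eq_zero hε ?_
    rw [Metric.mem_closedBall, not_le, dist_comm, Real.dist_eq] at hs
    exact hs.le

lemma HasWeakHolderBound.abs_mollify_sub_le {I : Set ℝ} {M α : ℝ} {g : ℝ → ℝ}
    (h : HasWeakHolderBound I M α g) (hg : LocallyIntegrable g) {ε δ : ℝ} (hε : 0 < ε)
    (hδ : 0 < δ) (hle : δ ≤ ε) {t : ℝ} (ht : Set.Icc (t - ε) (t + ε) ⊆ I) :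
    |mollify hε g t - mollify hδ g t| ≤ M * (2 * ε) ^ α := by
  -- the difference of the two mollifiers is the derivative of a test function
  set χ : ℝ → ℝ := fun s => mollifierPrimitive ε hε t s - mollifierPrimitive ε hδ t s
  have hderiv : ∀ s, deriv χ s = mollifier hε (t - s) - mollifier hδ (t - s) := fun s =>
    ((hasDerivAt_mollifierPrimitive hε t s).sub (hasDerivAt_mollifierPrimitive hδ t s)).deriv
  have hout : ∀ s ∉ Set.Icc (t - ε) (t + ε), χ s = 0 := by
    intro s hs
    rw [Set.mem_Icc, not_and_or, not_le, not_le] at hs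
    rcases hs with hs | hs
    · simp [χ, mollifierPrimitive_eq_zero _ le_rfl hs.le, mollifierPrimitive_eq_zero _ hle hs.le]
    · simp [χ, mollifierPrimitive_eq_one _ le_rfl hs.le, mollifierPrimitive_eq_one _ hle hs.le]
  have hbd : ∀ s, |χ s| ≤ 1 := by
    intro s
    by_cases hs : s ∈ Set.Icc (t - ε) (t + ε)
    · have h1 := mollifierPrimitive_mem_Icc hε hs.1
      have h2 := mollifierPrimitive_mem_Icc hδ hs.1
      rw [abs_le]
      constructor <;> simp only [χ] <;> linarith [h1.1, h1.2, h2.1, h2.2]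
    · rw [hout s hs]
      simp
  have := h (t - ε) (t + ε) χ (by linarith) ht
    ((contDiff_mollifierPrimitive hε t).sub (contDiff_mollifierPrimitive hδ t)) hout hbd
  simp only [hderiv, mul_sub] at this
  rw [integral_sub (integrable_mul_mollifier hg hε t) (integrable_mul_mollifier hg hδ t)] at this
  rwa [show t + ε - (t - ε) = 2 * ε by ring] at this

lemma HasWeakHolderBound.ae_abs_mollify_sub_le {I : Set ℝ} {M α : ℝ} {g : ℝ → ℝ}
    (h : HasWeakHolderBound I M α g) (hg : LocallyIntegrable g) :
    ∀ᵐ t, ∀ (ε : ℝ) (hε : 0 < ε), Set.Icc (t - ε) (t + ε) ⊆ I →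
      |mollify hε g t - g t| ≤ M * (2 * ε) ^ α := by
  filter_upwards [ae_tendsto_mollify hg] with t ht ε hε hI
  refine le_of_tendsto ((tendsto_const_nhds.sub ht).abs) ?_
  filter_upwards [(tendsto_one_div_add_atTop_nhds_zero_nat (𝕜 := ℝ)).eventually (gt_mem_nhds hε)]
    with j hj
  exact h.abs_mollify_sub_le hg hε _ hj.le hI

/-- Weakly convergent functions with uniformly bounded weak Hölder constants converge almost
everywhere. -/
lemma ae_tendsto_of_hasWeakHolderBound {I : Set ℝ} (hI : IsOpen I) {M α : ℝ}
    (hα : 0 < α) {c : ℕ → ℝ → ℝ} {c' : ℝ → ℝ} (hc : ∀ k, LocallyIntegrable (c k))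
    (hc' : LocallyIntegrable c') (hM : ∀ k, HasWeakHolderBound I M α (c k))
    (hlim : ∀ (χ : ℝ → ℝ) (a b : ℝ), Continuous χ → Set.Icc a b ⊆ I →
      (∀ s ∉ Set.Icc a b, χ s = 0) →
      Tendsto (fun k => ∫ s, c k s * χ s) atTop (𝓝 (∫ s, c' s * χ s))) :
    ∀ᵐ t, t ∈ I → Tendsto (fun k => c k t) atTop (𝓝 (c' t)) := by
  have h1 := ae_all_iff.2 fun k => (hM k).ae_abs_mollify_sub_le (hc k)
  filter_upwards [h1, ae_tendsto_mollify hc'] with t h1 h2 htI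
  rw [Metric.tendsto_nhds]
  intro η hη
  have hj := tendsto_one_div_add_atTop_nhds_zero_nat (𝕜 := ℝ)
  have e1 : ∀ᶠ ε in 𝓝 (0 : ℝ), Set.Icc (t - ε) (t + ε) ⊆ I := by
    obtain ⟨r, hr, hball⟩ := Metric.isOpen_iff.1 hI t htI
    filter_upwards [gt_mem_nhds hr] with ε hε s hs
    refine hball ?_
    rw [Metric.mem_ball, Real.dist_eq, abs_lt]
    constructor <;> linarith [hs.1, hs.2]
  have e2 : ∀ᶠ ε in 𝓝 (0 : ℝ), M * (2 * ε) ^ α < η / 3 := by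
    have : Tendsto (fun ε : ℝ => M * (2 * ε) ^ α) (𝓝 0) (𝓝 (M * (2 * 0) ^ α)) :=
      (((continuous_const.mul continuous_id).rpow_const
        fun _ => Or.inr hα.le).const_mul M).tendsto 0
    rw [mul_zero, Real.zero_rpow hα.ne', mul_zero] at this
    exact this.eventually (gt_mem_nhds (by positivity))
  have e3 := Metric.tendsto_nhds.1 h2 (η / 3) (by positivity)
  obtain ⟨j, h4, h5, h6⟩ := ((hj.eventually e1).and ((hj.eventually e2).and e3)).exists
  have hpos : 0 < 1 / ((j : ℝ) + 1) := Nat.one_div_pos_of_nat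
  have h7 := hlim (fun s => mollifier hpos (t - s)) (t - 1 / ((j : ℝ) + 1))
    (t + 1 / ((j : ℝ) + 1)) ((contDiff_mollifier hpos).continuous.comp (by fun_prop)) h4
    (fun s hs => mollifier_sub_eq_zero _ (by
      rw [Set.mem_Icc, not_and_or, not_le, not_le] at hs
      rw [le_abs]
      rcases hs with hs | hs
      · left; linarith
      · right; linarith))
  filter_upwards [Metric.tendsto_nhds.1 h7 (η / 3) (by positivity)] with k hk
  have h8 := h1 k _ hpos h4
  change dist (mollify hpos (c k) t) (mollify hpos c' t) < η / 3 at hk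
  rw [Real.dist_eq] at hk h6 ⊢
  rw [abs_lt] at hk h6 ⊢
  have h9 := abs_le.1 h8
  constructor <;> linarith [hk.1, hk.2, h6.1, h6.2, h9.1, h9.2]

/-- Functions with uniformly bounded weak Hölder constants and integrals are locally uniformly
bounded. -/
lemma exists_bound_of_hasWeakHolderBound {I : Set ℝ} (hI : IsOpen I) {M α M₁ : ℝ}
    {c : ℕ → ℝ → ℝ} (hc : ∀ k, LocallyIntegrable (c k))
    (hM : ∀ k, HasWeakHolderBound I M α (c k))
    (hM₁ : ∀ k a b, Set.Icc a b ⊆ I → b - a ≤ 1 → ∫ s in Set.Icc a b, |c k s| ≤ M₁)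
    {K : Set ℝ} (hK : IsCompact K) (hKI : K ⊆ I) :
    ∃ B, ∀ k, ∀ᵐ t, t ∈ K → |c k t| ≤ B := by
  obtain ⟨ε₀, hε₀, hthick⟩ := hK.exists_cthickening_subset_open hI hKI
  set ε := min ε₀ (1 / 2)
  have hε : 0 < ε := lt_min hε₀ (by norm_num)
  obtain ⟨R, hR⟩ : ∃ R, ∀ s, ‖mollifier hε s‖ ≤ R := by
    have hsupp : HasCompactSupport (mollifier hε) := ContDiffBump.hasCompactSupport_normed _
    exact hsupp.exists_bound_of_continuous (contDiff_mollifier hε).continuous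
  refine ⟨M * (2 * ε) ^ α + R * M₁, fun k => ?_⟩
  filter_upwards [(hM k).ae_abs_mollify_sub_le (hc k)] with t ht htK
  have hsub : Set.Icc (t - ε) (t + ε) ⊆ I := by
    intro s hs
    refine hthick (Metric.mem_cthickening_of_dist_le s t ε₀ K htK ?_)
    rw [Real.dist_eq]
    refine le_trans ?_ (min_le_left ε₀ (1 / 2))
    rw [abs_le]
    constructor <;> linarith [hs.1, hs.2]
  have h1 := ht ε hε hsub
  have h2 : |mollify hε (c k) t| ≤ R * M₁ := by
    have hR0 : 0 ≤ R := (norm_nonneg _).trans (hR 0)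
    have e : mollify hε (c k) t
        = ∫ s in Set.Icc (t - ε) (t + ε), c k s * mollifier hε (t - s) := by
      refine (setIntegral_eq_integral_of_forall_compl_eq_zero fun s hs => ?_).symm
      rw [mollifier_sub_eq_zero, mul_zero]
      rw [Set.mem_Icc, not_and_or, not_le, not_le] at hs
      rw [le_abs]
      rcases hs with hs | hs
      · left; linarith
      · right; linarith
    have hint : IntegrableOn (c k) (Set.Icc (t - ε) (t + ε)) :=
      (hc k).integrableOn_isCompact isCompact_Icc
    rw [e]
    calc |∫ s in Set.Icc (t - ε) (t + ε), c k s * mollifier hε (t - s)|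
        ≤ ∫ s in Set.Icc (t - ε) (t + ε), R * |c k s| := by
          rw [← Real.norm_eq_abs]
          refine norm_integral_le_of_norm_le (hint.norm.const_mul R)
            (Eventually.of_forall fun s => ?_)
          rw [norm_mul, mul_comm]
          exact mul_le_mul_of_nonneg_right (hR _) (norm_nonneg _)
      _ ≤ R * M₁ := by
          rw [integral_const_mul]
          refine mul_le_mul_of_nonneg_left (hM₁ k _ _ hsub ?_) hR0
          have : ε ≤ 1 / 2 := min_le_right _ _
          linarith
  have := abs_sub_abs_le_abs_sub (c k t) (mollify hε (c k) t)
  rw [abs_sub_comm] at this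
  linarith

end

/-! ### Equi-integrability of weakly convergent sequences -/

section

section Duality

variable {X H : Type*} [MeasurableSpace X] {μ : Measure X} [NormedAddCommGroup H]
  {p q : ℝ≥0∞}

lemma lt_two_of_holderConjugate (hp : 2 < p) [hpq : p.HolderConjugate q] : q < 2 := by
  by_contra! h
  have h1 := ENNReal.HolderConjugate.inv_add_inv_eq_one p q
  have h2 : p⁻¹ < 2⁻¹ := ENNReal.inv_lt_inv.2 hp
  have h3 : q⁻¹ ≤ 2⁻¹ := ENNReal.inv_le_inv.2 h
  have h4 : p⁻¹ + q⁻¹ < 2⁻¹ + 2⁻¹ :=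
    ENNReal.add_lt_add_of_lt_of_le (h3.trans_lt (by simp)).ne h2 h3
  rw [h1, ENNReal.inv_two_add_inv_two] at h4
  exact lt_irrefl _ h4

lemma memLp_two_restrict (hp : 2 ≤ p) (v : Lp H p μ) {E : Set X} (hE : μ E ≠ ⊤) :
    MemLp v 2 (μ.restrict E) := by
  have : IsFiniteMeasure (μ.restrict E) := ⟨by simpa using hE.lt_top⟩
  exact ((Lp.memLp v).restrict E).mono_exponent hp

lemma integrableOn_norm_sq (hp : 2 ≤ p) (v : Lp H p μ) {E : Set X} (hE : μ E ≠ ⊤) :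
    IntegrableOn (fun x => ‖v x‖ ^ 2) E μ :=
  (memLp_two_restrict hp v hE).integrable_norm_pow (by norm_num)

variable [InnerProductSpace ℝ H]

/-- A function in `Lᵖ`, `p > 2`, whose pairing with `L^q` has norm at most `C`, has equi-integrable
square, in a quantitative form: test with the function itself, cut off to the set `E`. -/
lemma setIntegral_norm_sq_le (hp : 2 < p) [p.HolderConjugate q] [Fact (1 ≤ q)] {C : ℝ}
    (hC : 0 ≤ C) (v : Lp H p μ) (hv : ∀ g : Lp H q μ, |∫ x, inner ℝ (v x) (g x) ∂μ| ≤ C * ‖g‖)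
    {E : Set X} (hE : MeasurableSet E) (hEfin : μ E ≠ ⊤) :
    ∫ x in E, ‖v x‖ ^ 2 ∂μ ≤ C ^ 2 * (μ.real E) ^ (2 / q.toReal - 1) := by
  have hq2 := lt_two_of_holderConjugate (q := q) hp
  have hq1 : 1 ≤ q := Fact.out
  have : IsFiniteMeasure (μ.restrict E) := ⟨by simpa using hEfin.lt_top⟩
  have hmem2 := memLp_two_restrict hp.le v hEfin
  have hmemq : MemLp (E.indicator v) q μ :=
    (memLp_indicator_iff_restrict hE).2 (hmem2.mono_exponent hq2.le)
  set N := (eLpNorm v 2 (μ.restrict E)).toReal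
  have hN : ∫ x in E, ‖v x‖ ^ 2 ∂μ = N ^ 2 := by
    have := hmem2.eLpNorm_eq_integral_rpow_norm (by norm_num) (by norm_num)
    simp only [N, this]
    rw [ENNReal.toReal_ofReal (by positivity), ← Real.rpow_natCast, ← Real.rpow_mul (by positivity)]
    simp
  have h1 := hv (hmemq.toLp _)
  have h2 : ∫ x, inner ℝ (v x) (hmemq.toLp _ x) ∂μ = ∫ x in E, ‖v x‖ ^ 2 ∂μ := by
    rw [← integral_indicator hE]
    refine integral_congr_ae ?_
    filter_upwards [hmemq.coeFn_toLp] with x hx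
    rw [hx]
    by_cases hxE : x ∈ E <;> simp [hxE]
  have h3 : ‖hmemq.toLp _‖ ≤ N * (μ.real E) ^ (1 / q.toReal - 1 / 2) := by
    rw [Lp.norm_toLp, eLpNorm_indicator_eq_eLpNorm_restrict hE]
    have := eLpNorm_le_eLpNorm_mul_rpow_measure_univ hq2.le hmem2.1
    rw [Measure.restrict_apply_univ] at this
    have hexp : 0 ≤ 1 / q.toReal - 1 / (2 : ℝ≥0∞).toReal := by
      rw [sub_nonneg]
      refine one_div_le_one_div_of_le
        (ENNReal.toReal_pos (one_pos.trans_le hq1).ne' (hq2.trans (by simp)).ne) ?_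
      exact ENNReal.toReal_mono (by simp) hq2.le
    have h4 := ENNReal.toReal_mono (ENNReal.mul_ne_top hmem2.2.ne
      (ENNReal.rpow_ne_top_of_nonneg hexp hEfin)) this
    rw [ENNReal.toReal_mul, ← ENNReal.toReal_rpow] at h4
    simpa [N, Measure.real] using h4
  rw [h2, hN, abs_of_nonneg (sq_nonneg _)] at h1
  have h5 : N ^ 2 ≤ C * (N * (μ.real E) ^ (1 / q.toReal - 1 / 2)) :=
    h1.trans (mul_le_mul_of_nonneg_left h3 hC)
  have hN0 : 0 ≤ N := ENNReal.toReal_nonneg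
  have hY : 0 ≤ (μ.real E) ^ (1 / q.toReal - 1 / 2) := by positivity
  have h6 : N ≤ C * (μ.real E) ^ (1 / q.toReal - 1 / 2) := by
    rcases hN0.eq_or_lt with h | h
    · rw [← h]
      positivity
    · refine le_of_mul_le_mul_left ?_ h
      linarith
  rw [hN]
  calc N ^ 2 ≤ (C * (μ.real E) ^ (1 / q.toReal - 1 / 2)) ^ 2 := by gcongr
    _ = _ := by
      rw [mul_pow, ← Real.rpow_natCast ((μ.real E) ^ _), ← Real.rpow_mul (by positivity)]
      congr 2
      push_cast
      ring

end Duality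

variable {n : ℕ} {I : Set ℝ} {p : ℝ≥0∞}

/-- A weakly convergent sequence and its limit have uniformly equi-integrable squares. -/
lemma WeaklyTendsto.exists_setIntegral_le (hp : 2 < p) {θ : ℕ → LpL2 n I p} {f : LpL2 n I p}
    (hf : WeaklyTendsto θ f) :
    ∃ C α : ℝ, 0 ≤ C ∧ 0 < α ∧ ∀ E ⊆ I, MeasurableSet E → volume E ≠ ⊤ →
      (∀ k, ∫ t in E, ‖θ k t‖ ^ 2 ≤ C * (volume.real E) ^ α) ∧
      ∫ t in E, ‖f t‖ ^ 2 ≤ C * (volume.real E) ^ α := by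
  have : Fact (1 ≤ p) := ⟨(one_le_two.trans_lt hp).le⟩
  set q := p.conjExponent
  have : p.HolderConjugate q := .conjExponent Fact.out
  have : Fact (1 ≤ q) := ⟨ENNReal.HolderConjugate.one_le q p⟩
  set μ := (volume : Measure ℝ).restrict I
  let Λ : LpL2 n I p → (LpL2 n I q →L[ℝ] ℝ) := ContinuousLinearMap.lpPairing μ p q (innerSL ℝ)
  have hΛ : ∀ v g, Λ v g = ∫ t in I, inner ℝ (v t) (g t) := fun v g =>
    ContinuousLinearMap.lpPairing_eq_integral _ v g
  obtain ⟨C, hC⟩ := banach_steinhaus (g := fun k => Λ (θ k)) fun g => by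
    have := (hf q inferInstance g).norm.bddAbove_range
    obtain ⟨C, hC⟩ := this
    exact ⟨C, fun k => by rw [hΛ]; exact hC ⟨k, rfl⟩⟩
  have key : ∀ (v : LpL2 n I p), ‖Λ v‖ ≤ max C ‖Λ f‖ → ∀ E ⊆ I, MeasurableSet E →
      volume E ≠ ⊤ → ∫ t in E, ‖v t‖ ^ 2 ≤
        (max C ‖Λ f‖) ^ 2 * (volume.real E) ^ (2 / q.toReal - 1) := by
    intro v hv E hEI hE hfin
    have hμE : μ E = volume E := by
      rw [Measure.restrict_apply hE, Set.inter_eq_left.2 hEI]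
    have h1 := setIntegral_norm_sq_le (q := q) (μ := μ) hp
      ((norm_nonneg _).trans (le_max_right C ‖Λ f‖)) v (fun g => ?_) hE (hμE ▸ hfin)
    · rwa [Measure.real, hμE, Measure.restrict_restrict hE, Set.inter_eq_left.2 hEI] at h1
    · rw [← hΛ]
      exact (Λ v).le_of_opNorm_le hv g
  refine ⟨(max C ‖Λ f‖) ^ 2, 2 / q.toReal - 1, sq_nonneg _, ?_, fun E hEI hE hfin =>
    ⟨fun k => key _ ((hC k).trans (le_max_left _ _)) E hEI hE hfin,
      key _ (le_max_right _ _) E hEI hE hfin⟩⟩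
  have hq2 := lt_two_of_holderConjugate (q := q) hp
  have hq1 : 1 ≤ q := Fact.out
  have hqpos : 0 < q.toReal :=
    ENNReal.toReal_pos (one_pos.trans_le hq1).ne' (hq2.trans (by simp)).ne
  rw [sub_pos, one_lt_div hqpos]
  exact (ENNReal.toReal_lt_toReal (hq2.trans (by simp)).ne (by simp)).2 hq2

end

/-! ### Weak solutions in terms of inner products -/

section

variable {n : ℕ} {I : Set ℝ} {p : ℝ≥0∞}

section

variable {m : (Fin n → ℝ) → Fin n → ℂ} (hm : IsSymbol m)

/-- The quadratic form `θ ↦ ∫ ψ θ Tˡ[θ] dx`, for real-valued continuous weights `ψ`. -/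
def realQuadForm (l : Fin n) (ψ : C(Torus n, ℝ)) (v : L2Torus n) : ℝ :=
  ⟪v, mulL ℝ n ψ (driftL hm l v)⟫_ℝ

/-- A continuous real-valued function on the torus, as a complex-valued one. -/
def toComplexC (ψ : C(Torus n, ℝ)) : C(Torus n, ℂ) :=
  ContinuousMap.comp ⟨Complex.ofReal, Complex.continuous_ofReal⟩ ψ

lemma continuous_toComplexC : Continuous (toComplexC (n := n)) :=
  ContinuousMap.continuous_postcomp _

lemma quadForm_toComplexC (l : Fin n) (ψ : C(Torus n, ℝ)) (v : L2Torus n) :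
    quadForm hm l (toComplexC ψ) v = realQuadForm hm l ψ v := by
  rw [quadForm, toComplexC, ← ofRealL_mulL, inner_ofRealL, realQuadForm]

lemma abs_realQuadForm_le (l : Fin n) (ψ : C(Torus n, ℝ)) (v : L2Torus n) :
    |realQuadForm hm l ψ v| ≤ ‖ψ‖ * ‖driftL hm l‖ * ‖v‖ ^ 2 := by
  refine (abs_real_inner_le_norm _ _).trans ?_
  calc _ ≤ ‖v‖ * (‖ψ‖ * (‖driftL hm l‖ * ‖v‖)) := by
        gcongr
        refine (norm_mulL_le _ _).trans ?_
        gcongr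
        exact (driftL hm l).le_opNorm v
    _ = _ := by ring

lemma continuous_realQuadForm (l : Fin n) :
    Continuous fun z : C(Torus n, ℝ) × L2Torus n => realQuadForm hm l z.1 z.2 := by
  unfold realQuadForm
  fun_prop

lemma realQuadForm_smul (l : Fin n) (c : ℝ) (ψ : C(Torus n, ℝ)) (v : L2Torus n) :
    realQuadForm hm l (c • ψ) v = c * realQuadForm hm l ψ v := by
  simp [realQuadForm, inner_smul_right]

lemma realQuadForm_zero (l : Fin n) (v : L2Torus n) : realQuadForm hm l 0 v = 0 := by
  simp [realQuadForm]

/-- The class of a continuous function in `L²(𝕋ⁿ)`. -/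
abbrev toL2 (ψ : C(Torus n, ℝ)) : L2Torus n := ContinuousMap.toLp 2 (torusMeasure n) ℝ ψ

/-- Weak solutions, with the drift eliminated and the space integrals written as `L²` inner
products. -/
lemma isWeakSolution_iff (θ : LpL2 n I p) :
    IsWeakSolution m θ ↔ ∀ (φ : ℝ → Torus n → ℝ) (hφ : IsTestFunction I φ),
      (∫ t in I, ∑ l, ⟪driftL hm l (θ t), toL2 (hφ.dxC l t)⟫_ℝ = 0) ∧
      ∫ t in I, (⟪θ t, toL2 (hφ.dtC t)⟫_ℝ + ∑ l, realQuadForm hm l (hφ.dxC l t) (θ t)) = 0 := by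
  have h1 : ∀ (φ : ℝ → Torus n → ℝ) (hφ : IsTestFunction I φ) (u : Fin n → L2Torus n) (t : ℝ),
      ∫ x, ∑ l, u l x * dx l φ t x ∂torusMeasure n = ∑ l, ⟪u l, toL2 (hφ.dxC l t)⟫_ℝ := by
    intro φ hφ u t
    refine (integral_finsetSum _ fun l _ =>
      integrable_mul_continuousMap (hφ.dxC l t) (u l)).trans ?_
    exact Finset.sum_congr rfl fun l _ => (inner_toLp_eq (hφ.dxC l t) (u l)).symm
  have h2 : ∀ (φ : ℝ → Torus n → ℝ) (hφ : IsTestFunction I φ) (v : L2Torus n)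
      (u : Fin n → L2Torus n) (t : ℝ),
      ∫ x, (v x * dt φ t x + ∑ l, v x * u l x * dx l φ t x) ∂torusMeasure n =
      ⟪v, toL2 (hφ.dtC t)⟫_ℝ + ∑ l, ⟪v, mulL ℝ n (hφ.dxC l t) (u l)⟫_ℝ := by
    intro φ hφ v u t
    have hint := fun l => integrable_mul_mul_continuousMap (hφ.dxC l t) v (u l)
    have := integral_add (integrable_mul_continuousMap (hφ.dtC t) v)
      (integrable_finsetSum Finset.univ fun l _ => hint l)
    refine this.trans ?_
    rw [integral_finsetSum _ fun l _ => hint l, inner_toLp_eq]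
    simp only [inner_mulL_eq]
  have key : ∀ u : Fin n → LpL2 n I p,
      (∀ᵐ t ∂((volume : Measure ℝ).restrict I), IsDrift m (θ t) (fun l => u l t)) →
      ∀ (φ : ℝ → Torus n → ℝ) (hφ : IsTestFunction I φ),
      (∫ t in I, ∫ x, ∑ l, (u l t) x * dx l φ t x ∂(torusMeasure n)
        = ∫ t in I, ∑ l, ⟪driftL hm l (θ t), toL2 (hφ.dxC l t)⟫_ℝ) ∧
      ∫ t in I, ∫ x,
        ((θ t) x * dt φ t x + ∑ l, (θ t) x * (u l t) x * dx l φ t x) ∂(torusMeasure n)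
      = ∫ t in I, (⟪θ t, toL2 (hφ.dtC t)⟫_ℝ + ∑ l, realQuadForm hm l (hφ.dxC l t) (θ t)) := by
    intro u hu φ hφ
    constructor
    · refine integral_congr_ae ?_
      filter_upwards [hu] with t ht
      rw [isDrift_iff hm] at ht
      rw [h1 φ hφ (fun l => u l t) t]
      simp only [ht]
    · refine integral_congr_ae ?_
      filter_upwards [hu] with t ht
      rw [isDrift_iff hm] at ht
      rw [h2 φ hφ (θ t) (fun l => u l t) t]
      simp only [ht, realQuadForm]
  constructor
  · rintro ⟨u, hu, hdiv, heq⟩ φ hφ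
    obtain ⟨k1, k2⟩ := key u hu φ hφ
    exact ⟨k1 ▸ hdiv φ hφ, k2 ▸ heq φ hφ⟩
  · intro h
    have hu : ∀ᵐ t ∂((volume : Measure ℝ).restrict I),
        IsDrift m (θ t) (fun l => (driftL hm l).compLp θ t) := by
      have := ae_all_iff.2 fun l => (driftL hm l).coeFn_compLp θ
      filter_upwards [this] with t ht
      rw [isDrift_iff hm]
      exact ht
    refine ⟨fun l => (driftL hm l).compLp θ, hu, fun φ hφ => ?_, fun φ hφ => ?_⟩
    · rw [(key _ hu φ hφ).1, (h φ hφ).1]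
    · rw [(key _ hu φ hφ).2, (h φ hφ).2]

lemma integrableOn_norm_sq_of_subset (hp : 2 ≤ p) (θ : LpL2 n I p) {E : Set ℝ} (hEI : E ⊆ I)
    (hE : volume E ≠ ⊤) : IntegrableOn (fun t => ‖θ t‖ ^ 2) E := by
  have h1 : ((volume : Measure ℝ).restrict I) E = volume E := Measure.restrict_eq_self _ hEI
  have := integrableOn_norm_sq hp θ (h1 ▸ hE)
  rwa [IntegrableOn, Measure.restrict_restrict_of_subset hEI] at this

lemma integrable_realQuadForm (hp : 2 ≤ p) (θ : LpL2 n I p) (l : Fin n)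
    (ψ : C(ℝ, C(Torus n, ℝ))) {K : Set ℝ} (hK : IsCompact K) (hKI : K ⊆ I)
    (h0 : ∀ t ∉ K, ψ t = 0) :
    IntegrableOn (fun t => realQuadForm hm l (ψ t) (θ t)) I := by
  obtain ⟨R, hR⟩ := hK.exists_bound_of_continuousOn ψ.continuous.continuousOn
  have h1 := (integrableOn_norm_sq_of_subset hp θ hKI hK.measure_ne_top).const_mul
    (R * ‖driftL hm l‖)
  have h2 : Integrable (K.indicator fun t => R * ‖driftL hm l‖ * ‖θ t‖ ^ 2)
      ((volume : Measure ℝ).restrict I) :=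
    (((integrable_indicator_iff hK.measurableSet).2 h1)).restrict
  refine h2.mono' ?_ (Eventually.of_forall fun t => ?_)
  · have hψ : AEStronglyMeasurable (fun t => ψ t) ((volume : Measure ℝ).restrict I) :=
      ψ.continuous.aestronglyMeasurable
    have hθ : AEStronglyMeasurable (fun t => θ t) ((volume : Measure ℝ).restrict I) :=
      Lp.aestronglyMeasurable θ
    have hpair : AEStronglyMeasurable (fun t => (ψ t, (θ t : L2Torus n)))
      ((volume : Measure ℝ).restrict I) := hψ.prodMk hθ
    have hcomp := (continuous_realQuadForm hm l).comp_aestronglyMeasurable hpair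
    exact hcomp
  · by_cases ht : t ∈ K
    · rw [Set.indicator_of_mem ht]
      refine (abs_realQuadForm_le hm l _ _).trans ?_
      gcongr
      exact hR t ht
    · rw [Set.indicator_of_notMem ht, h0 t ht, realQuadForm_zero, norm_zero]

end

/-- A continuous compactly supported function of time with values in `L²(𝕋ⁿ)`, as an element
of `L^q(I; L²(𝕋ⁿ))`. -/
lemma exists_LpL2_of_continuous (I : Set ℝ) (q : ℝ≥0∞) {G : ℝ → L2Torus n} (hG : Continuous G)
    {K : Set ℝ} (hK : IsCompact K) (h0 : ∀ t ∉ K, G t = 0) :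
    ∃ g : LpL2 n I q, ∀ᵐ t ∂((volume : Measure ℝ).restrict I), g t = G t := by
  have h : MemLp G q ((volume : Measure ℝ).restrict I) :=
    (hG.memLp_of_hasCompactSupport (HasCompactSupport.intro hK h0)).restrict I
  exact ⟨h.toLp G, h.coeFn_toLp⟩

/-- Weak convergence, tested against continuous compactly supported functions of time. -/
lemma WeaklyTendsto.tendsto_integral (hp : 2 < p) {θ : ℕ → LpL2 n I p} {f : LpL2 n I p}
    (hf : WeaklyTendsto θ f) {G : ℝ → L2Torus n} (hG : Continuous G)
    {K : Set ℝ} (hK : IsCompact K) (h0 : ∀ t ∉ K, G t = 0) :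
    Tendsto (fun k => ∫ t in I, ⟪θ k t, G t⟫_ℝ) atTop (𝓝 (∫ t in I, ⟪f t, G t⟫_ℝ)) := by
  obtain ⟨g, hg⟩ := exists_LpL2_of_continuous I p.conjExponent hG hK h0
  have h := hf p.conjExponent (.conjExponent (one_le_two.trans_lt hp).le) g
  have e : ∀ v : LpL2 n I p, ∫ t in I, ⟪v t, g t⟫_ℝ = ∫ t in I, ⟪v t, G t⟫_ℝ := by
    intro v
    refine integral_congr_ae ?_
    filter_upwards [hg] with t ht
    rw [ht]
  simpa only [e] using h

lemma integrable_inner_continuous (hp : 2 < p) (θ : LpL2 n I p) {G : ℝ → L2Torus n}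
    (hG : Continuous G) {K : Set ℝ} (hK : IsCompact K) (h0 : ∀ t ∉ K, G t = 0) :
    IntegrableOn (fun t => ⟪θ t, G t⟫_ℝ) I := by
  have : p.HolderConjugate p.conjExponent := .conjExponent (one_le_two.trans_lt hp).le
  have hG' : MemLp G p.conjExponent ((volume : Measure ℝ).restrict I) :=
    (hG.memLp_of_hasCompactSupport (HasCompactSupport.intro hK h0)).restrict I
  exact memLp_one_iff_integrable.1
    ((innerSL ℝ : L2Torus n →L[ℝ] L2Torus n →L[ℝ] ℝ).memLp_of_bilin 1 (Lp.memLp θ) hG')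

end

/-! ### Passage to the limit -/

section

variable {n : ℕ} {I : Set ℝ} {p : ℝ≥0∞}

/-- The time-dependent moment `t ↦ ∫ θ(t) w dx`, extended by zero outside `I`. -/
def moment (w : C(Torus n, ℝ)) (θ : LpL2 n I p) : ℝ → ℝ :=
  I.indicator fun t => ⟪θ t, toL2 w⟫_ℝ

lemma moment_of_mem (w : C(Torus n, ℝ)) (θ : LpL2 n I p) {t : ℝ} (ht : t ∈ I) :
    moment w θ t = ⟪θ t, toL2 w⟫_ℝ := Set.indicator_of_mem ht _

lemma locallyIntegrable_moment (hI : MeasurableSet I) (hp : 1 ≤ p) (w : C(Torus n, ℝ))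
    (θ : LpL2 n I p) : LocallyIntegrable (moment w θ) := by
  have h1 : MemLp (fun t => ⟪θ t, toL2 w⟫_ℝ) p ((volume : Measure ℝ).restrict I) :=
    (Lp.memLp θ).inner_const (toL2 w)
  exact ((memLp_indicator_iff_restrict hI).2 h1).locallyIntegrable hp

lemma integral_moment_mul (hI : MeasurableSet I) (w : C(Torus n, ℝ)) (θ : LpL2 n I p)
    (χ : ℝ → ℝ) : ∫ t, moment w θ t * χ t = ∫ t in I, ⟪θ t, χ t • toL2 w⟫_ℝ := by
  rw [← integral_indicator hI]
  congr 1
  ext t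
  by_cases ht : t ∈ I
  · rw [moment_of_mem w θ ht, Set.indicator_of_mem ht, inner_smul_right, mul_comm]
  · simp [moment, ht]

/-- The equation bounds the time derivative of the moments of a weak solution: by the square of the
`L²` norm of the solution, the nonlinearity being quadratic. -/
lemma IsWeakSolution.hasWeakHolderBound {m : (Fin n → ℝ) → Fin n → ℂ} (hm : IsSymbol m)
    (hI : MeasurableSet I) (hp : 2 < p) {w : C(Torus n, ℝ)} {w' : Fin n → C(Torus n, ℝ)}
    (hw : IsTorusSmooth w) (hw' : ∀ l x, w' l x = torusDeriv w l x) {θ : LpL2 n I p}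
    (hθ : IsWeakSolution m θ) {C α : ℝ}
    (hC : ∀ E ⊆ I, MeasurableSet E → volume E ≠ ⊤ →
      ∫ t in E, ‖θ t‖ ^ 2 ≤ C * (volume.real E) ^ α) :
    HasWeakHolderBound I ((∑ l, ‖w' l‖ * ‖driftL hm l‖) * C) α (moment w θ) := by
  intro a b χ hab hsub hχ h0 hχ1
  have hφ := isTestFunction_mul hχ isCompact_Icc hsub h0 hw
  have hdt : ∀ t, hφ.dtC t = deriv χ t • w := by
    intro t
    ext x
    rw [hφ.dtC_apply, dt_mul]
    rfl
  have hdx : ∀ l t, hφ.dxC l t = χ t • w' l := by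
    intro l t
    ext x
    rw [hφ.dxC_apply, dx_mul, ← hw']
    rfl
  have hχ' : ∀ t ∉ Set.Icc a b, deriv χ t = 0 := by
    intro t ht
    have : χ =ᶠ[𝓝 t] fun _ => 0 := by
      filter_upwards [isClosed_Icc.isOpen_compl.mem_nhds ht] with s hs
      exact h0 s hs
    rw [this.deriv_eq, deriv_const]
  have heq := ((isWeakSolution_iff hm θ).1 hθ _ hφ).2
  have hA : IntegrableOn (fun t => ⟪θ t, toL2 (hφ.dtC t)⟫_ℝ) I := by
    refine integrable_inner_continuous hp θ (G := fun t => toL2 (hφ.dtC t)) (by fun_prop)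
      (isCompact_Icc (a := a) (b := b)) fun t ht => ?_
    rw [hdt, hχ' t ht, zero_smul, toL2, map_zero]
  have hB : ∀ l, IntegrableOn (fun t => realQuadForm hm l (hφ.dxC l t) (θ t)) I := by
    intro l
    refine integrable_realQuadForm hm hp.le θ l (hφ.dxC l) isCompact_Icc hsub fun t ht => ?_
    rw [hdx, h0 t ht, zero_smul]
  rw [integral_add hA (integrable_finsetSum _ fun l _ => hB l)] at heq
  have e : ∫ t in I, ⟪θ t, toL2 (hφ.dtC t)⟫_ℝ = ∫ t, moment w θ t * deriv χ t := by
    rw [integral_moment_mul hI]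
    simp only [hdt, toL2, map_smul]
  rw [← e, eq_neg_of_add_eq_zero_left heq, abs_neg]
  have hrestr : ∫ t in I, ∑ l, realQuadForm hm l (hφ.dxC l t) (θ t)
      = ∫ t in Set.Icc a b, ∑ l, realQuadForm hm l (hφ.dxC l t) (θ t) := by
    refine setIntegral_eq_of_subset_of_forall_sdiff_eq_zero hI hsub fun t ht => ?_
    refine Finset.sum_eq_zero fun l _ => ?_
    rw [hdx, h0 t ht.2, zero_smul, realQuadForm_zero]
  have hfin : volume (Set.Icc a b) ≠ ⊤ := isCompact_Icc.measure_ne_top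
  rw [hrestr]
  calc |∫ t in Set.Icc a b, ∑ l, realQuadForm hm l (hφ.dxC l t) (θ t)|
      ≤ ∫ t in Set.Icc a b, (∑ l, ‖w' l‖ * ‖driftL hm l‖) * ‖θ t‖ ^ 2 := by
        rw [← Real.norm_eq_abs]
        refine norm_integral_le_of_norm_le
          ((integrableOn_norm_sq_of_subset hp.le θ hsub hfin).const_mul _)
          (Eventually.of_forall fun t => ?_)
        rw [Finset.sum_mul]
        refine norm_sum_le_of_le _ fun l _ => ?_
        rw [hdx, realQuadForm_smul, norm_mul]
        calc _ ≤ 1 * |realQuadForm hm l (w' l) (θ t)| := by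
              gcongr
              · exact hχ1 t
              · exact le_rfl
          _ ≤ _ := by
              rw [one_mul]
              exact abs_realQuadForm_le hm l _ _
    _ = (∑ l, ‖w' l‖ * ‖driftL hm l‖) * ∫ t in Set.Icc a b, ‖θ t‖ ^ 2 := integral_const_mul _ _
    _ ≤ (∑ l, ‖w' l‖ * ‖driftL hm l‖) * (C * (b - a) ^ α) := by
        have := hC _ hsub measurableSet_Icc hfin
        rw [Real.volume_real_Icc_of_le hab.le] at this
        gcongr
    _ = _ := by ring

section

variable {m : (Fin n → ℝ) → Fin n → ℂ} (hm : IsSymbol m) (hI : IsOpen I) (hp : 2 < p)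
  {θ : ℕ → LpL2 n I p} {f : LpL2 n I p} (hθ : ∀ k, IsWeakSolution m (θ k))
  (hf : WeaklyTendsto θ f)

include hm hI hp hθ hf

lemma ae_tendsto_moment {w : C(Torus n, ℝ)} (hw : IsTorusSmooth w) :
    (∀ᵐ t, t ∈ I → Tendsto (fun k => ⟪θ k t, toL2 w⟫_ℝ) atTop (𝓝 ⟪f t, toL2 w⟫_ℝ)) ∧
    ∀ K, IsCompact K → K ⊆ I → ∃ B, ∀ k, ∀ᵐ t, t ∈ K → |⟪θ k t, toL2 w⟫_ℝ| ≤ B := by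
  obtain ⟨w', hw'⟩ := hw.exists_deriv
  obtain ⟨C, α, hC0, hα, hC⟩ := hf.exists_setIntegral_le hp
  have hp1 : 1 ≤ p := (one_le_two.trans_lt hp).le
  have hloc := fun v : LpL2 n I p => locallyIntegrable_moment hI.measurableSet hp1 w v
  have hM := fun k => (hθ k).hasWeakHolderBound hm hI.measurableSet hp hw hw'
    fun E h1 h2 h3 => (hC E h1 h2 h3).1 k
  constructor
  · have := ae_tendsto_of_hasWeakHolderBound hI hα (fun k => hloc (θ k)) (hloc f) hM
      fun χ a b hχ hsub h0 => ?_
    · filter_upwards [this] with t ht htI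
      simpa only [moment_of_mem w _ htI] using ht htI
    · simp only [integral_moment_mul hI.measurableSet]
      exact hf.tendsto_integral hp (hχ.smul continuous_const) (isCompact_Icc (a := a) (b := b))
        fun t ht => by rw [h0 t ht, zero_smul]
  · intro K hK hKI
    have := exists_bound_of_hasWeakHolderBound hI (fun k => hloc (θ k)) hM
      (M₁ := ‖toL2 w‖ * (1 + C)) (fun k a b hsub hab => ?_) hK hKI
    · obtain ⟨B, hB⟩ := this
      refine ⟨B, fun k => ?_⟩
      filter_upwards [hB k] with t ht htK
      simpa only [moment_of_mem w _ (hKI htK)] using ht htK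
    · have hfin : volume (Set.Icc a b) ≠ ⊤ := isCompact_Icc.measure_ne_top
      have hle : volume.real (Set.Icc a b) ≤ 1 := by
        rw [Real.volume_real_Icc]
        exact max_le hab zero_le_one
      have hone : IntegrableOn (fun _ => (1 : ℝ)) (Set.Icc a b) := integrableOn_const hfin
      have hsq := integrableOn_norm_sq_of_subset hp.le (θ k) hsub hfin
      have hint : IntegrableOn (fun t => 1 + ‖θ k t‖ ^ 2) (Set.Icc a b) := hone.add hsq
      calc ∫ s in Set.Icc a b, |moment w (θ k) s|
          ≤ ∫ s in Set.Icc a b, ‖toL2 w‖ * (1 + ‖θ k s‖ ^ 2) := by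
            refine setIntegral_mono_on ((hloc (θ k)).integrableOn_isCompact isCompact_Icc).norm
              (hint.const_mul _) measurableSet_Icc fun s hs => ?_
            rw [moment_of_mem w _ (hsub hs)]
            refine (abs_real_inner_le_norm _ _).trans ?_
            rw [mul_comm]
            gcongr
            nlinarith [sq_nonneg (‖θ k s‖ - 1)]
        _ = ‖toL2 w‖ * (volume.real (Set.Icc a b) + ∫ s in Set.Icc a b, ‖θ k s‖ ^ 2) := by
            rw [integral_const_mul, integral_add hone hsq, setIntegral_const,
              smul_eq_mul, mul_one]
        _ ≤ ‖toL2 w‖ * (1 + C) := by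
            gcongr
            refine ((hC _ hsub measurableSet_Icc hfin).1 k).trans ?_
            exact mul_le_of_le_one_right hC0
              (Real.rpow_le_one measureReal_nonneg hle hα.le)

/-- The Fourier coefficients of the weakly convergent solutions converge strongly: at almost every
time, and boundedly on compact time intervals. -/
lemma ae_tendsto_fourierCoeff (j : Fin n → ℤ) :
    (∀ᵐ t, t ∈ I → Tendsto (fun k => fourierCoeff (θ k t) j) atTop (𝓝 (fourierCoeff (f t) j))) ∧
    ∀ K, IsCompact K → K ⊆ I → ∃ B, 0 ≤ B ∧
      ∀ k, ∀ᵐ t, t ∈ K → ‖fourierCoeff (θ k t) j‖ ≤ B := by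
  obtain ⟨h1, h2⟩ := ae_tendsto_moment hm hI hp hθ hf (isTorusSmooth_reChar (-j))
  obtain ⟨h3, h4⟩ := ae_tendsto_moment hm hI hp hθ hf (isTorusSmooth_imChar (-j))
  constructor
  · filter_upwards [h1, h3] with t h1 h3 htI
    simp only [fourierCoeff_eq_inner]
    exact ((Complex.continuous_ofReal.tendsto _).comp (h1 htI)).add
      (((Complex.continuous_ofReal.tendsto _).comp (h3 htI)).mul_const _)
  · intro K hK hKI
    obtain ⟨B, hB⟩ := h2 K hK hKI
    obtain ⟨B', hB'⟩ := h4 K hK hKI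
    refine ⟨max (B + B') 0, le_max_right _ _, fun k => ?_⟩
    filter_upwards [hB k, hB' k] with t h1 h2 htK
    rw [fourierCoeff_eq_inner]
    refine (norm_add_le _ _).trans (le_trans ?_ (le_max_left _ _))
    rw [norm_mul, Complex.norm_I, mul_one, Complex.norm_real, Complex.norm_real]
    exact add_le_add (h1 htK) (h2 htK)

end

lemma pairDiff_le (v w : L2Torus n) (q : (Fin n → ℤ) × (Fin n → ℤ)) :
    pairDiff v w q ≤ ‖v‖ ^ 2 + ‖w‖ ^ 2 := by
  refine (norm_sub_le _ _).trans ?_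
  rw [norm_mul, norm_mul, RCLike.norm_conj, RCLike.norm_conj, sq, sq]
  gcongr <;> exact norm_fourierCoeff_le _ _

lemma continuous_pairDiff (q : (Fin n → ℤ) × (Fin n → ℤ)) :
    Continuous fun z : L2Torus n × L2Torus n => pairDiff z.1 z.2 q := by
  simp only [pairDiff, ← fourierCoeffL_apply]
  fun_prop

lemma aestronglyMeasurable_pairDiff (v w : LpL2 n I p) (q : (Fin n → ℤ) × (Fin n → ℤ)) :
    AEStronglyMeasurable (fun t => pairDiff (v t) (w t) q) ((volume : Measure ℝ).restrict I) := by
  have hv : AEStronglyMeasurable (fun t => v t) ((volume : Measure ℝ).restrict I) :=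
    Lp.aestronglyMeasurable v
  have hw : AEStronglyMeasurable (fun t => w t) ((volume : Measure ℝ).restrict I) :=
    Lp.aestronglyMeasurable w
  have hpair : AEStronglyMeasurable (fun t => ((v t : L2Torus n), (w t : L2Torus n)))
    ((volume : Measure ℝ).restrict I) := hv.prodMk hw
  have hcomp := (continuous_pairDiff q).comp_aestronglyMeasurable hpair
  exact hcomp

lemma integrableOn_pairDiff (hp : 2 ≤ p) (v w : LpL2 n I p) (q : (Fin n → ℤ) × (Fin n → ℤ))
    {K : Set ℝ} (hKI : K ⊆ I) (hK : volume K ≠ ⊤) :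
    IntegrableOn (fun t => pairDiff (v t) (w t) q) K := by
  refine ((integrableOn_norm_sq_of_subset hp v hKI hK).add
    (integrableOn_norm_sq_of_subset hp w hKI hK)).mono' ?_ (Eventually.of_forall fun t => ?_)
  · exact (aestronglyMeasurable_pairDiff v w q).mono_measure (Measure.restrict_mono_set _ hKI)
  · rw [Real.norm_of_nonneg (pairDiff_nonneg _ _ _)]
    exact pairDiff_le _ _ _

section

variable {m : (Fin n → ℝ) → Fin n → ℂ} (hm : IsSymbol m) (hI : IsOpen I) (hp : 2 < p)
  {θ : ℕ → LpL2 n I p} {f : LpL2 n I p} (hθ : ∀ k, IsWeakSolution m (θ k))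
  (hf : WeaklyTendsto θ f)

include hm hI hp hθ hf

lemma tendsto_setIntegral_pairDiff (q : (Fin n → ℤ) × (Fin n → ℤ)) {K : Set ℝ} (hK : IsCompact K)
    (hKI : K ⊆ I) :
    Tendsto (fun k => ∫ t in K, pairDiff (θ k t) (f t) q) atTop (𝓝 0) := by
  obtain ⟨h1, h2⟩ := ae_tendsto_fourierCoeff hm hI hp hθ hf q.1
  obtain ⟨h3, h4⟩ := ae_tendsto_fourierCoeff hm hI hp hθ hf q.2
  obtain ⟨B, hB0, hB⟩ := h2 K hK hKI
  obtain ⟨B', hB0', hB'⟩ := h4 K hK hKI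
  have hconv : ∀ᵐ t ∂(volume : Measure ℝ).restrict K,
      Tendsto (fun k => conj (fourierCoeff (θ k t) q.1) * fourierCoeff (θ k t) q.2) atTop
        (𝓝 (conj (fourierCoeff (f t) q.1) * fourierCoeff (f t) q.2)) := by
    rw [ae_restrict_iff' hK.measurableSet]
    filter_upwards [h1, h3] with t h1 h3 htK
    exact ((Complex.continuous_conj.tendsto _).comp (h1 (hKI htK))).mul (h3 (hKI htK))
  have hbd : ∀ k, ∀ᵐ t ∂(volume : Measure ℝ).restrict K,
      ‖conj (fourierCoeff (θ k t) q.1) * fourierCoeff (θ k t) q.2‖ ≤ B * B' := by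
    intro k
    rw [ae_restrict_iff' hK.measurableSet]
    filter_upwards [hB k, hB' k] with t h1 h2 htK
    rw [norm_mul, RCLike.norm_conj]
    exact mul_le_mul (h1 htK) (h2 htK) (norm_nonneg _) hB0
  rw [← integral_zero ℝ ℝ (μ := (volume : Measure ℝ).restrict K)]
  refine tendsto_integral_of_dominated_convergence (fun _ => B * B' + B * B') (fun k => ?_)
    (integrableOn_const hK.measure_ne_top) (fun k => ?_) ?_
  · exact (aestronglyMeasurable_pairDiff _ _ q).mono_measure (Measure.restrict_mono_set _ hKI)
  · filter_upwards [hbd k, hconv, ae_all_iff.2 hbd] with t h1 h2 h3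
    rw [Real.norm_of_nonneg (pairDiff_nonneg _ _ _)]
    exact (norm_sub_le _ _).trans
      (add_le_add h1 (le_of_tendsto h2.norm (Eventually.of_forall h3)))
  · filter_upwards [hconv] with t ht
    have := (ht.sub_const (conj (fourierCoeff (f t) q.1) * fourierCoeff (f t) q.2)).norm
    simpa [pairDiff] using this

/-- Convergence of the nonlinear term of the equation. -/
lemma tendsto_integral_realQuadForm (hodd : ∀ ξ : Fin n → ℝ, ξ ≠ 0 → m (-ξ) = -m ξ) (l : Fin n)
    (ψ : C(ℝ, C(Torus n, ℝ))) {K : Set ℝ} (hK : IsCompact K) (hKI : K ⊆ I)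
    (h0 : ∀ t ∉ K, ψ t = 0) :
    Tendsto (fun k => ∫ t in I, realQuadForm hm l (ψ t) (θ k t)) atTop
      (𝓝 (∫ t in I, realQuadForm hm l (ψ t) (f t))) := by
  obtain ⟨C, α, hC0, hα, hC⟩ := hf.exists_setIntegral_le hp
  have hCK := hC K hKI hK.measurableSet hK.measure_ne_top
  set R := C * (volume.real K) ^ α
  have hR : 0 ≤ R := by positivity
  rw [Metric.tendsto_nhds]
  intro ε hε
  have hcpt : IsCompact (toComplexC '' (ψ '' K)) :=
    (hK.image ψ.continuous).image continuous_toComplexC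
  obtain ⟨S, C', hC', H⟩ := isFinitelyControlled_of_isCompact (hm := hm) (l := l) hodd hcpt
    (ε / 2 / (2 * R + 1)) (by positivity)
  have hsum : Tendsto (fun k => C' * ∑ q ∈ S, ∫ t in K, pairDiff (θ k t) (f t) q) atTop (𝓝 0) := by
    have := (tendsto_finsetSum S fun q _ =>
      tendsto_setIntegral_pairDiff hm hI hp hθ hf q hK hKI).const_mul C'
    simpa using this
  filter_upwards [hsum.eventually (gt_mem_nhds (half_pos hε))] with k hk
  have hsqk := integrableOn_norm_sq_of_subset hp.le (θ k) hKI hK.measure_ne_top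
  have hsqf := integrableOn_norm_sq_of_subset hp.le f hKI hK.measure_ne_top
  have hpd := fun q => integrableOn_pairDiff hp.le (θ k) f q hKI hK.measure_ne_top
  have hint1 : IntegrableOn (fun t => ε / 2 / (2 * R + 1) * (‖θ k t‖ ^ 2 + ‖f t‖ ^ 2)) K :=
    (hsqk.add hsqf).const_mul _
  have hint2 : IntegrableOn (fun t => C' * ∑ q ∈ S, pairDiff (θ k t) (f t) q) K :=
    (integrable_finsetSum S fun q _ => hpd q).const_mul C'
  rw [Real.dist_eq, ← integral_sub (integrable_realQuadForm hm hp.le _ l ψ hK hKI h0)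
    (integrable_realQuadForm hm hp.le _ l ψ hK hKI h0),
    setIntegral_eq_of_subset_of_forall_sdiff_eq_zero hI.measurableSet hKI fun t ht => by
      rw [h0 t ht.2, realQuadForm_zero, realQuadForm_zero, sub_zero]]
  calc |∫ t in K, (realQuadForm hm l (ψ t) (θ k t) - realQuadForm hm l (ψ t) (f t))|
      ≤ ∫ t in K, (ε / 2 / (2 * R + 1) * (‖θ k t‖ ^ 2 + ‖f t‖ ^ 2)
          + C' * ∑ q ∈ S, pairDiff (θ k t) (f t) q) := by
        rw [← Real.norm_eq_abs]
        refine norm_integral_le_of_norm_le (hint1.add hint2) ?_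
        filter_upwards [ae_restrict_mem hK.measurableSet] with t ht
        have := H (toComplexC (ψ t)) ⟨_, ⟨t, ht, rfl⟩, rfl⟩ (θ k t) (f t)
        rwa [quadForm_toComplexC, quadForm_toComplexC, ← Complex.ofReal_sub,
          Complex.norm_real] at this
    _ = ε / 2 / (2 * R + 1) * ((∫ t in K, ‖θ k t‖ ^ 2) + ∫ t in K, ‖f t‖ ^ 2)
          + C' * ∑ q ∈ S, ∫ t in K, pairDiff (θ k t) (f t) q := by
        rw [integral_add hint1 hint2, integral_const_mul, integral_const_mul,
          integral_add hsqk hsqf, integral_finsetSum S fun q _ => hpd q]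
    _ ≤ ε / 2 / (2 * R + 1) * (R + R) + C' * ∑ q ∈ S, ∫ t in K, pairDiff (θ k t) (f t) q := by
        gcongr
        · exact hCK.1 k
        · exact hCK.2
    _ < ε / 2 + ε / 2 := by
        refine add_lt_add_of_le_of_lt ?_ hk
        rw [div_mul_eq_mul_div, div_le_iff₀ (by positivity)]
        nlinarith
    _ = ε := add_halves ε

/-- The weak limit of the solutions is a weak solution. -/
lemma isWeakSolution_of_weaklyTendsto (hodd : ∀ ξ : Fin n → ℝ, ξ ≠ 0 → m (-ξ) = -m ξ) :
    IsWeakSolution m f := by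
  rw [isWeakSolution_iff hm]
  intro φ hφ
  obtain ⟨K, hK, hKI, hdt0, hdx0⟩ := hφ.exists_support_derivatives
  have hsol := fun k => (isWeakSolution_iff hm (θ k)).1 (hθ k) φ hφ
  constructor
  · set G : ℝ → L2Torus n := fun t =>
      ∑ l, ContinuousLinearMap.adjoint (driftL hm l) (toL2 (hφ.dxC l t))
    have hG : Continuous G := by fun_prop
    have hG0 : ∀ t ∉ K, G t = 0 := fun t ht =>
      Finset.sum_eq_zero fun l _ => by rw [hdx0 l t ht, toL2, map_zero, map_zero]
    have e : ∀ (v : L2Torus n) (t : ℝ),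
        ∑ l, ⟪driftL hm l v, toL2 (hφ.dxC l t)⟫_ℝ = ⟪v, G t⟫_ℝ := by
      intro v t
      rw [inner_sum]
      exact Finset.sum_congr rfl fun l _ => (ContinuousLinearMap.adjoint_inner_right _ _ _).symm
    have hlim := hf.tendsto_integral hp hG hK hG0
    simp only [e] at hsol ⊢
    simp only [(hsol _).1] at hlim
    exact tendsto_nhds_unique hlim tendsto_const_nhds
  · have hG : Continuous fun t => toL2 (hφ.dtC t) := by fun_prop
    have hG0 : ∀ t ∉ K, toL2 (hφ.dtC t) = 0 := fun t ht => by rw [hdt0 t ht, toL2, map_zero]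
    have hlin := hf.tendsto_integral hp hG hK hG0
    have hquad := tendsto_finsetSum Finset.univ fun l _ =>
      tendsto_integral_realQuadForm hm hI hp hθ hf hodd l (hφ.dxC l) hK hKI (hdx0 l)
    have split : ∀ v : LpL2 n I p,
        ∫ t in I, (⟪v t, toL2 (hφ.dtC t)⟫_ℝ + ∑ l, realQuadForm hm l (hφ.dxC l t) (v t))
        = (∫ t in I, ⟪v t, toL2 (hφ.dtC t)⟫_ℝ)
          + ∑ l, ∫ t in I, realQuadForm hm l (hφ.dxC l t) (v t) := by
      intro v
      have hint := fun l => integrable_realQuadForm hm hp.le v l (hφ.dxC l) hK hKI (hdx0 l)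
      rw [integral_add (integrable_inner_continuous hp v hG hK hG0)
        (integrable_finsetSum _ fun l _ => hint l), integral_finsetSum _ fun l _ => hint l]
    have hlim := hlin.add hquad
    simp only [split] at hsol ⊢
    simp only [(hsol _).2] at hlim
    exact tendsto_nhds_unique hlim tendsto_const_nhds

end

end

end ActiveScalar

end

theorem theorem1p4 (n : ℕ) (m : (Fin n → ℝ) → Fin n → ℂ) (hm : ActiveScalar.IsSymbol m)
    (hodd : ∀ ξ : Fin n → ℝ, ξ ≠ 0 → m (-ξ) = -m ξ)
    (I : Set ℝ) (hIopen : IsOpen I) (hI : I.OrdConnected)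
    (p : ℝ≥0∞) (hp : 2 < p)
    (θ : ℕ → ActiveScalar.LpL2 n I p) (f : ActiveScalar.LpL2 n I p)
    (hθ : ∀ k, ActiveScalar.IsWeakSolution m (θ k))
    (hf : ActiveScalar.WeaklyTendsto θ f) :
    ActiveScalar.IsWeakSolution m f :=
  ActiveScalar.isWeakSolution_of_weaklyTendsto hm hIopen hp hθ hf hodd
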